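/- Let $E$ be a simple euclidean Jordan algebra (finite-dimensional, real, with identity $e$) of rank $r$, i.e. every Jordan frame of $E$ has $r$ elements. Every $x\in E$ has a spectral decomposition $x=\sum_{i=1}^r x_i c_i$ with respect to some Jordan frame $(c_1,\dots,c_r)$, and the spectral values $x_1,\dots,x_r$ are unique up to order. Put $\Delta(x)=\prod_i x_i$ and $\mathrm{ind}(x)=\sum_i \mathrm{sgn}(x_i)$. Let $E^\times$ be the set of invertible elements, and for $j\in\{r,r-2,\dots,-r\}$ let $E^\times_j=\{x\in E^\times : \mathrm{ind}(x)=j\}$. (It is known that these are the connected components of $E^\times$; this is background and not part of the claim.) Let $C=\{x^2 : x\in E\}$, let $C^0$ be its interior, and let $C^\star=\{\lambda\in E^* : \lambda(v)\ge 0 \text{ for all } v\in C\}$. Let $s\in\mathbb R$ and let $\mu_s$ be the Riesz measure with parameter $s$, i.e. the positive Borel measure on $E^*$, supported in $C^\star$, with Laplace transform $$\int_{E^*} e^{-\lambda(y)}\,d\mu_s(\lambda)=\Delta(y)^{-s}\qquad (y\in C^0)$$ for those $s$ for which such a measure exists. (By known results it is unique, and it exists exactly for $s\in\{0,\tfrac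 d2,\dots,(r-1)\tfrac d2\}\cup((r-1)\tfrac d2,\infty)$, where $d$ is the dimension of the off-diagonal Peirce spaces.) Fix a Lebesgue measure $dx$ on $E$, and let $\tilde\mu_s$ be the Fourier transform of $\mu_s$, the antilinear functional $$\tilde\mu_s(\phi)=\int_{E^*}\Big(\int_E e^{i\lambda(x)}\,\overline{\phi(x)}\,dx\Big)d\mu_s(\lambda).$$ The imaginary part of an antilinear functional $D$ is $(\operatorname{Im}D)(\phi)=\frac1{2i}\big(D(\phi)-\overline{D(\overline\phi)}\big)$. Then: 1. $\mu_s$ is tempered, i.e. $\int_{E^*}(1+\|\lambda\|)^{-N}\,d\mu_s(\lambda)<\infty$ for some $N\in\mathbb N$ (so $\tilde\mu_s$ is a tempered distribution on $E$). 2. On $E^\times$ the distribution $\tilde\mu_s$ is given by the function $|\Delta(x)|^{-s}\,e^{\mathrm{ind}(x)\,s\pi i/2}$: for every $\phi\in C_c^\infty(E^\times)$, the function $\overline{\phi(x)}\,|\Delta(x)|^{-s}e^{\mathrm{ind}(x)s\pi i/2}$ is integrable and $$\tilde\mu_s(\phi)=\int_E \overline{\phi(x)}\,|\Delta(x)|^{-s}\,e^{\mathrm{ind}(x)\,s\pi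 i/2}\,dx.$$ 3. For every $j\in\{r,r-2,\dots,-r\}$, $\operatorname{Im}\tilde\mu_s$ vanishes on $E^\times_j$ (i.e. $(\operatorname{Im}\tilde\mu_s)(\phi)=0$ for all $\phi\in C_c^\infty(E^\times_j)$) if and only if $sj\in 2\mathbb Z$. -/

import Mathlib

open MeasureTheory
open scoped ContDiff ComplexConjugate

namespace JordanRiesz

section Algebra

variable (E : Type*) [AddCommGroup E] [Module ℝ E] [Mul E] [One E]

/-- A real unital Jordan algebra: the product is bilinear, commutative, has the identity `1`, and
satisfies `x (x² y) = x² (x y)`. -/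
structure IsJordanAlgebra : Prop where
  mul_add : ∀ x y z : E, x * (y + z) = x * y + x * z
  mul_smul : ∀ (t : ℝ) (x y : E), x * (t • y) = t • (x * y)
  mul_comm : ∀ x y : E, x * y = y * x
  jordan : ∀ x y : E, x * ((x * x) * y) = (x * x) * (x * y)
  one_mul : ∀ x : E, 1 * x = x

/-- A simple euclidean Jordan algebra: a real unital Jordan algebra that admits an inner product
for which every multiplication operator `L(x) y = x y` is symmetric, that is nonzero, and whose
only ideals are `0` and the whole algebra. -/
structure IsSimpleEuclideanJordanAlgebra : Prop extends IsJordanAlgebra E where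
  exists_inner : ∃ B : LinearMap.BilinForm ℝ E,
    (∀ x y, B x y = B y x) ∧ (∀ x, x ≠ 0 → 0 < B x x) ∧
      ∀ x y z, B (x * y) z = B y (x * z)
  nontrivial : Nontrivial E
  simple : ∀ I : Submodule ℝ E, (∀ x, ∀ y ∈ I, x * y ∈ I) → I = ⊥ ∨ I = ⊤

variable {E}

/-- `c` is a primitive idempotent: a nonzero idempotent that is not the sum of two nonzero
idempotents. -/
def IsPrimitiveIdempotent (c : E) : Prop :=
  c * c = c ∧ c ≠ 0 ∧ ¬ ∃ a b : E, a * a = a ∧ b * b = b ∧ a ≠ 0 ∧ b ≠ 0 ∧ c = a + b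

/-- A Jordan frame: primitive idempotents `c₁, …, c_r` with `c_i c_j = 0` for `i ≠ j` and
`c₁ + ⋯ + c_r = 1`. -/
structure IsJordanFrame {r : ℕ} (c : Fin r → E) : Prop where
  primitive : ∀ i, IsPrimitiveIdempotent (c i)
  orthogonal : ∀ i j, i ≠ j → c i * c j = 0
  sum_eq_one : ∑ i, c i = 1

variable (E) in
/-- The rank: the number of elements of a Jordan frame (it does not depend on the frame). -/
noncomputable def rank : ℕ := sInf {r : ℕ | ∃ c : Fin r → E, IsJordanFrame c}

/-- `m` is the multiset `x₁, …, x_r` of coefficients in a spectral decomposition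
`x = ∑ x_j c_j` of `x` with respect to a Jordan frame `c₁, …, c_r`. -/
def IsSpectrum (x : E) (m : Multiset ℝ) : Prop :=
  ∃ (r : ℕ) (c : Fin r → E) (a : Fin r → ℝ),
    IsJordanFrame c ∧ x = ∑ j, a j • c j ∧ m = Finset.univ.val.map a

open Classical in
/-- The spectral values `x₁, …, x_r` of `x`, with multiplicity. In a euclidean Jordan algebra a
spectral decomposition exists and the multiset of its coefficients depends only on `x`. -/
noncomputable def spectralValues (x : E) : Multiset ℝ :=
  if h : ∃ m, IsSpectrum x m then h.choose else 0

/-- The Jordan determinant `Δ(x) = ∏ x_j`. -/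
noncomputable def det (x : E) : ℝ := (spectralValues x).prod

/-- The index `ind(x) = ∑ sgn(x_j)`. -/
noncomputable def ind (x : E) : ℤ :=
  ((spectralValues x).map fun t : ℝ => ((SignType.sign t : SignType) : ℤ)).sum

variable (E) in
/-- The set `E^×` of invertible elements: `x` is invertible if some `y` satisfies `x y = 1` and
`x² y = x`. -/
def invertibles : Set E := {x | ∃ y : E, x * y = 1 ∧ (x * x) * y = x}

variable (E) in
/-- `E^×_j`, the set of invertible elements of index `j`. -/
def invertiblesOfIndex (j : ℤ) : Set E := {x | x ∈ invertibles E ∧ ind x = j}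

variable (E) in
/-- The cone `C` of squares. -/
def cone : Set E := {x | ∃ y : E, x = y * y}

end Algebra

section Analysis

variable {E : Type*} [NormedAddCommGroup E] [NormedSpace ℝ E]

/-- `φ` is a complex-valued test function on the open set `U`: smooth, with compact support
contained in `U`. -/
structure IsTestFunctionOn (U : Set E) (φ : E → ℂ) : Prop where
  smooth : ContDiff ℝ ∞ φ
  compact : HasCompactSupport φ
  support_subset : tsupport φ ⊆ U

/-- The Fourier transform of a measure `μ` on the dual space, as an antilinear functional on test
functions: `φ ↦ ∫_{E*} (∫_E e^{iλ(x)} conj(φ(x)) dν(x)) dμ(λ)`, where `ν` is a Lebesgue measure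
on `E`. -/
noncomputable def fourierDistribution [MeasurableSpace E] (ν : Measure E)
    (μ : Measure (StrongDual ℝ E)) (φ : E → ℂ) : ℂ :=
  ∫ l : StrongDual ℝ E, (∫ x : E, Complex.exp (Complex.I * ((l x : ℝ) : ℂ)) * conj (φ x) ∂ν) ∂μ

/-- The imaginary part of an antilinear functional `D`: the antilinear functional
`φ ↦ (D(φ) - conj(D(conj φ))) / 2i`, whose value at a real-valued `φ` is `Im (D(φ))`. -/
noncomputable def imPart (D : (E → ℂ) → ℂ) (φ : E → ℂ) : ℂ :=
  (D φ - conj (D fun x => conj (φ x))) / (2 * Complex.I)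

/-- The distribution `D` vanishes on the open set `U`. -/
def VanishesOn (D : (E → ℂ) → ℂ) (U : Set E) : Prop :=
  ∀ φ : E → ℂ, IsTestFunctionOn U φ → D φ = 0

variable [Mul E] [One E]

variable (E) in
/-- The dual cone `C* = {λ ∈ E* : λ(v) ≥ 0 for all v ∈ C}`. -/
def dualCone : Set (StrongDual ℝ E) := {l | ∀ v ∈ cone E, 0 ≤ l v}

/-- `μ` is the Riesz measure with parameter `s`: the positive Borel measure on the dual space,
supported in the dual cone, whose Laplace transform on the open cone `C⁰` is `Δ^{-s}`. -/
structure IsRieszMeasure (s : ℝ) (μ : Measure (StrongDual ℝ E)) : Prop where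
  support : μ (dualCone E)ᶜ = 0
  integrable : ∀ y ∈ interior (cone E),
    Integrable (fun l : StrongDual ℝ E => Real.exp (-(l y))) μ
  laplace : ∀ y ∈ interior (cone E),
    ∫ l : StrongDual ℝ E, Real.exp (-(l y)) ∂μ = det y ^ (-s)

end Analysis

end JordanRiesz

set_option linter.unusedSectionVars false

/-! Damp the Riesz measure by `exp (-ε λ(1))`. The damped measure is finite, and its Fourier
transform at `x = ∑ aᵢ cᵢ` is formally the Laplace transform at `ε1 - ix`. For small real `u` the
Laplace transform at `ε1 + ux` is `∏ (ε + u aᵢ)^(-s)`. Both sides are analytic in `u` on a vertical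
strip, so the identity continues to `u = -i` and gives `∏ (ε - i aᵢ)^(-s)`
(`IsRieszMeasure.fourier_damped`).

Let `ε → 0`. For invertible `x` the limit is `∏ (-i aᵢ)^(-s)`. The principal logarithm of `-i a` is
`log |a| - sgn(a) iπ/2`, so the phases add up to the index (`neg_I_mul_cpow`). On compact sets of
invertible elements the `|aᵢ|` are bounded away from zero and infinity, so dominated convergence
applies on `E`. On the dual side, `λ(1) ≥ 0` almost everywhere and the Laplace transform along the
ray through `1` is a power of `ε`. Hence a negative power of `1 + |λ(1)|` is integrable
(`exists_integrable_pow`), which gives temperedness and, with the decay of Fourier integrals of test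
functions, domination. On `E^×_j` the imaginary part is `sin(sjπ/2) |Δ|^(-s)`; a bump function
detects whether the sine vanishes.

All this needs `det` and `ind` to be independent of the chosen decomposition. Power associativity
and an invariant inner product give spectral decompositions. That all frames have the same size
follows from density and compactness (`IsJordanFrame.card_system_le`): elements with the maximal
number of independent powers are dense, they decompose along maximal systems of idempotents, and
such decompositions survive limits. -/

namespace JordanRiesz

/-! ### Power associativity and invariant inner products -/

section JordanAlgebra

variable {E : Type*} [AddCommGroup E] [Module ℝ E] [Mul E] [One E]

namespace IsJordanAlgebra


/-- The product of a Jordan algebra as a bilinear map. -/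
def lmul (hJ : IsJordanAlgebra E) : E →ₗ[ℝ] E →ₗ[ℝ] E :=
  LinearMap.mk₂ ℝ (fun x y => x * y)
    (fun x y z => by rw [hJ.mul_comm, hJ.mul_add, hJ.mul_comm z x, hJ.mul_comm z y])
    (fun t x y => by rw [hJ.mul_comm, hJ.mul_smul, hJ.mul_comm y x])
    (fun x y z => hJ.mul_add x y z) (fun t x y => hJ.mul_smul t x y)

@[simp] lemma lmul_apply (hJ : IsJordanAlgebra E) (x y : E) : hJ.lmul x y = x * y := rfl

lemma mul_zero (hJ : IsJordanAlgebra E) (x : E) : x * 0 = 0 := map_zero (hJ.lmul x)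

lemma mul_sub (hJ : IsJordanAlgebra E) (x y z : E) : x * (y - z) = x * y - x * z :=
  map_sub (hJ.lmul x) y z

lemma mul_sum (hJ : IsJordanAlgebra E) {ι : Type*} (s : Finset ι) (x : E) (f : ι → E) :
    x * ∑ i ∈ s, f i = ∑ i ∈ s, x * f i := map_sum (hJ.lmul x) f s

lemma zero_mul (hJ : IsJordanAlgebra E) (x : E) : 0 * x = 0 := by
  rw [hJ.mul_comm, hJ.mul_zero]

lemma add_mul (hJ : IsJordanAlgebra E) (x y z : E) : (x + y) * z = x * z + y * z := by
  rw [hJ.mul_comm, hJ.mul_add, hJ.mul_comm z x, hJ.mul_comm z y]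

lemma sub_mul (hJ : IsJordanAlgebra E) (x y z : E) : (x - y) * z = x * z - y * z := by
  rw [hJ.mul_comm, hJ.mul_sub, hJ.mul_comm z x, hJ.mul_comm z y]

lemma smul_mul (hJ : IsJordanAlgebra E) (t : ℝ) (x y : E) : (t • x) * y = t • (x * y) := by
  rw [hJ.mul_comm, hJ.mul_smul, hJ.mul_comm]

lemma sum_mul (hJ : IsJordanAlgebra E) {ι : Type*} (s : Finset ι) (x : E) (f : ι → E) :
    (∑ i ∈ s, f i) * x = ∑ i ∈ s, f i * x := by
  rw [hJ.mul_comm, hJ.mul_sum]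
  exact Finset.sum_congr rfl fun i _ => hJ.mul_comm _ _

lemma mul_one (hJ : IsJordanAlgebra E) (x : E) : x * 1 = x := by
  rw [hJ.mul_comm, hJ.one_mul]

/-- The linearised Jordan identity. -/
lemma linearized (hJ : IsJordanAlgebra E) (x y w : E) :
    ((x * x) * y) * w - (x * x) * (y * w) =
      (2 : ℝ) • ((x * y) * (x * w)) - (2 : ℝ) • (x * (y * (x * w))) := by
  -- The difference of the identities at `x + w` and `x - w` keeps the terms odd in `w`; the cubic
  -- one is the identity at `w` itself.
  have h1 := hJ.jordan (x + w) y
  have h2 := hJ.jordan (x - w) y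
  have h3 := hJ.jordan w y
  simp only [hJ.add_mul, hJ.mul_add, hJ.sub_mul, hJ.mul_sub] at h1 h2
  have e1 : ((x * x) * y) * w = w * (x * x * y) := hJ.mul_comm _ _
  have e2 : (x * x) * (y * w) = x * x * (w * y) := by rw [hJ.mul_comm y w]
  have e3 : (x * y) * (x * w) = x * w * (x * y) := hJ.mul_comm _ _
  have e4 : x * (y * (x * w)) = x * (x * w * y) := by rw [hJ.mul_comm y]
  rw [e1, e2, e3, e4]
  simp only [hJ.mul_comm w x] at h1 h2
  have key : (2 : ℝ) • (w * (x * x * y) - x * x * (w * y) - ((2 : ℝ) • (x * w * (x * y)) -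
      (2 : ℝ) • (x * (x * w * y)))) = 0 := by
    linear_combination (norm := module) h1 - h2 - (2 : ℝ) • h3
  rw [smul_eq_zero] at key
  exact sub_eq_zero.mp (key.resolve_left two_ne_zero)

/-- The linearised identity read as an identity of operators in `w`; it drives the induction on
powers. -/
lemma lmul_sq_mul (hJ : IsJordanAlgebra E) (x y : E) :
    hJ.lmul ((x * x) * y) = hJ.lmul (x * x) * hJ.lmul y +
      (2 : ℝ) • (hJ.lmul (x * y) * hJ.lmul x) -
        (2 : ℝ) • (hJ.lmul x * hJ.lmul y * hJ.lmul x) := by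
  ext w
  have h := hJ.linearized x y w
  simp only [LinearMap.add_apply, LinearMap.sub_apply, LinearMap.smul_apply,
    Module.End.mul_apply, lmul_apply]
  rw [sub_eq_iff_eq_add] at h
  rw [h]; abel

/-- Powers of an element, as left-normed products. -/
def pow (hJ : IsJordanAlgebra E) (x : E) (n : ℕ) : E := (hJ.lmul x ^ n) 1

lemma pow_zero (hJ : IsJordanAlgebra E) (x : E) : hJ.pow x 0 = 1 := rfl

lemma pow_succ (hJ : IsJordanAlgebra E) (x : E) (n : ℕ) :
    hJ.pow x (n + 1) = x * hJ.pow x n := by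
  simp [pow, _root_.pow_succ', Module.End.mul_apply]

lemma lmul_one (hJ : IsJordanAlgebra E) : hJ.lmul 1 = 1 := by
  ext w; simp [hJ.one_mul]

lemma commute_lmul_sq (hJ : IsJordanAlgebra E) (x : E) :
    Commute (hJ.lmul (x * x)) (hJ.lmul x) := by
  ext w
  simp [Module.End.mul_apply, hJ.jordan]

/-- Since `L(xⁿ)` commutes with `L(x)`, `xⁿ⁺² = x² xⁿ`. Then `lmul_sq_mul` writes `L(xⁿ⁺²)` through
`L(x²)`, `L(x)`, `L(xⁿ)` and `L(xⁿ⁺¹)`, all of which commute with `L(x)` and `L(x²)`. -/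
lemma commute_pow (hJ : IsJordanAlgebra E) (x : E) (n : ℕ) :
    Commute (hJ.lmul (hJ.pow x n)) (hJ.lmul x) ∧
      Commute (hJ.lmul (hJ.pow x n)) (hJ.lmul (x * x)) := by
  induction n using Nat.twoStepInduction with
  | zero => simp only [pow_zero, lmul_one]; exact ⟨Commute.one_left _, Commute.one_left _⟩
  | one =>
    rw [pow_succ, pow_zero, hJ.mul_one]
    exact ⟨Commute.refl _, (hJ.commute_lmul_sq x).symm⟩
  | more n h0 h1 =>
    have e : hJ.pow x (n + 2) = (x * x) * hJ.pow x n := by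
      have h := congrArg (fun T => T x) h0.1.eq
      simp only [Module.End.mul_apply, lmul_apply] at h
      rw [hJ.pow_succ, hJ.pow_succ, hJ.mul_comm (x * x), h, hJ.mul_comm x (hJ.pow x n)]
    rw [e, hJ.lmul_sq_mul, ← hJ.pow_succ]
    have a1 := hJ.commute_lmul_sq x
    refine ⟨?_, ?_⟩
    · exact ((a1.mul_left h0.1).add_left ((h1.1.mul_left (Commute.refl _)).smul_left _)).sub_left
        ((((Commute.refl _).mul_left h0.1).mul_left (Commute.refl _)).smul_left _)
    · exact (((Commute.refl _).mul_left h0.2).add_left ((h1.2.mul_left a1.symm).smul_left _)).sub_left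
        (((a1.symm.mul_left h0.2).mul_left a1.symm).smul_left _)

/-- Evaluation of a real polynomial at an element of a Jordan algebra. -/
noncomputable def eval (hJ : IsJordanAlgebra E) (x : E) (p : Polynomial ℝ) : E :=
  (Polynomial.aeval (hJ.lmul x) p) 1

lemma commute_lmul_eval (hJ : IsJordanAlgebra E) (x : E) (p : Polynomial ℝ) :
    Commute (hJ.lmul (hJ.eval x p)) (hJ.lmul x) := by
  induction p using Polynomial.induction_on' with
  | add p q hp hq =>
    have : hJ.eval x (p + q) = hJ.eval x p + hJ.eval x q := by simp [eval]
    rw [this, map_add]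
    exact hp.add_left hq
  | monomial n a =>
    have : hJ.eval x (Polynomial.monomial n a) = a • hJ.pow x n := by
      simp [eval, pow, Polynomial.aeval_monomial, Module.algebraMap_end_apply,
        Module.End.mul_apply]
    rw [this, map_smul]
    exact (hJ.commute_pow x n).1.smul_left a

/-- Power associativity: `L(p(x))` commutes with `L(x)`, hence with `q(L(x))`; apply both products
to `1`. -/
lemma eval_mul_eval (hJ : IsJordanAlgebra E) (x : E) (p q : Polynomial ℝ) :
    hJ.eval x p * hJ.eval x q = hJ.eval x (p * q) := by
  have h : Commute (hJ.lmul (hJ.eval x p)) (Polynomial.aeval (hJ.lmul x) q) := by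
    have hx := hJ.commute_lmul_eval x p
    induction q using Polynomial.induction_on' with
    | add q r hq hr => rw [map_add]; exact hq.add_right hr
    | monomial n a =>
      rw [Polynomial.aeval_monomial]
      exact Commute.mul_right (Algebra.commutes a _).symm (hx.pow_right n)
  have h1 := congrArg (fun T => T 1) h.eq
  simp only [Module.End.mul_apply, lmul_apply, hJ.mul_one] at h1
  change hJ.eval x p * hJ.eval x q = _ at h1
  rw [h1, _root_.mul_comm p q]
  simp only [eval, map_mul, Module.End.mul_apply]

lemma eval_eq_sum (hJ : IsJordanAlgebra E) {ι : Type*} [Fintype ι] {x : E} {w : ι → E} {a : ι → ℝ}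
    (hw : ∀ i, x * w i = a i • w i) (h1 : ∑ i, w i = 1) (p : Polynomial ℝ) :
    hJ.eval x p = ∑ i, p.eval (a i) • w i := by
  rw [eval, ← h1, map_sum]
  refine Finset.sum_congr rfl fun i _ => ?_
  have := Module.End.aeval_apply_of_hasEigenvector (f := hJ.lmul x) (p := p) (μ := a i) (x := w i)
  by_cases h0 : w i = 0
  · simp [h0]
  · exact this ⟨Module.End.mem_eigenspace_iff.mpr (hw i), h0⟩

end IsJordanAlgebra

/-- A symmetric, positive definite bilinear form for which the multiplications are symmetric. -/
structure IsEuclideanForm (B : LinearMap.BilinForm ℝ E) : Prop where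
  symm : ∀ x y, B x y = B y x
  pos : ∀ x, x ≠ 0 → 0 < B x x
  assoc : ∀ x y z, B (x * y) z = B y (x * z)

namespace IsEuclideanForm

variable {B : LinearMap.BilinForm ℝ E}

lemma nonneg (hB : IsEuclideanForm B) (x : E) : 0 ≤ B x x := by
  by_cases h : x = 0
  · simp [h]
  · exact (hB.pos x h).le

lemma eq_zero (hB : IsEuclideanForm B) {x : E} (h : B x x ≤ 0) : x = 0 := by
  by_contra h0
  exact absurd (hB.pos x h0) (not_lt.mpr h)

/-- Multiplication by an idempotent is positive semidefinite. -/
lemma idem_nonneg (hB : IsEuclideanForm B) (hJ : IsJordanAlgebra E) {c : E} (hc : c * c = c)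
    (v : E) : B (c * v) (c * v) ≤ B (c * v) v := by
  -- With `L = L(c)` this is `L = 3L² - 2L³`, which implies `L - L² = 4(L - L²)²`, a positive
  -- operator.
  have h (w : E) : c * w = c * (c * w) + (2 : ℝ) • (c * (c * w)) - (2 : ℝ) • (c * (c * (c * w))) := by
    have h := congrArg (fun T => T w) (hJ.lmul_sq_mul c c)
    simpa [hc] using h
  have h1 := congrArg (fun z => B z v) (h v)
  have h2 := congrArg (fun z => B z v) (h (c * v))
  have hu := hB.nonneg (c * v - c * (c * v))
  have e2 : B (c * (c * v)) v = B (c * v) (c * v) := hB.assoc _ _ _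
  have e3 : B (c * (c * (c * v))) v = B (c * v) (c * (c * v)) := by
    rw [hB.assoc, hB.assoc]
  have e3' : B (c * (c * v)) (c * v) = B (c * v) (c * (c * v)) := hB.assoc _ _ _
  have e4 : B (c * (c * (c * (c * v)))) v = B (c * (c * v)) (c * (c * v)) := by
    rw [hB.assoc, hB.assoc]
  simp only [map_add, map_sub, map_smul, LinearMap.add_apply, LinearMap.sub_apply,
    LinearMap.smul_apply, smul_eq_mul, e2, e3, e3', e4] at h1 h2 hu
  linarith

lemma mul_eq_zero_of_form_eq_zero (hB : IsEuclideanForm B) (hJ : IsJordanAlgebra E) {c v : E}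
    (hc : c * c = c) (h : B (c * v) v ≤ 0) : c * v = 0 :=
  hB.eq_zero ((hB.idem_nonneg hJ hc v).trans h)

/-- An idempotent orthogonal to a sum of idempotents is orthogonal to each of them. -/
lemma mul_eq_zero_of_sum (hB : IsEuclideanForm B) (hJ : IsJordanAlgebra E) {ι : Type*}
    {s : Finset ι} {c : ι → E} (hc : ∀ i ∈ s, c i * c i = c i) {q : E}
    (h : (∑ i ∈ s, c i) * q = 0) {i : ι} (hi : i ∈ s) : c i * q = 0 := by
  have hn : ∀ j ∈ s, 0 ≤ B (c j * q) q := fun j hj =>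
    (hB.nonneg _).trans (hB.idem_nonneg hJ (hc j hj) q)
  have hs : ∑ j ∈ s, B (c j * q) q = 0 := by
    rw [hJ.sum_mul] at h
    have := congrArg (fun z => B z q) h
    simpa using this
  exact hB.mul_eq_zero_of_form_eq_zero hJ (hc i hi) ((Finset.sum_eq_zero_iff_of_nonneg hn).mp hs i hi).le

/-- Multiplication operators are diagonalizable. -/
lemma exists_eigen_decomposition [FiniteDimensional ℝ E] (hB : IsEuclideanForm B)
    (hJ : IsJordanAlgebra E) (x : E) :
    ∃ (n : ℕ) (w : Fin n → E) (a : Fin n → ℝ), (∀ i, x * w i = a i • w i) ∧ ∑ i, w i = 1 := by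
  let core : InnerProductSpace.Core ℝ E :=
    { inner := fun x y => B x y
      conj_inner_symm := fun x y => hB.symm y x
      re_inner_nonneg := fun x => hB.nonneg x
      add_left := fun x y z => by simp
      smul_left := fun x y t => by simp
      definite := fun x h => hB.eq_zero (le_of_eq h) }
  let _ : NormedAddCommGroup E := core.toNormedAddCommGroup
  let _ : InnerProductSpace ℝ E := InnerProductSpace.ofCore core.toCore
  have hT : (hJ.lmul x).IsSymmetric := fun y z => hB.assoc x y z
  refine ⟨Module.finrank ℝ E, fun i => (inner ℝ (hT.eigenvectorBasis rfl i) 1 : ℝ) •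
    hT.eigenvectorBasis rfl i, hT.eigenvalues rfl, fun i => ?_, ?_⟩
  · have := hT.apply_eigenvectorBasis rfl i
    rw [hJ.mul_smul, smul_comm]
    exact congrArg _ this
  · exact (hT.eigenvectorBasis rfl).sum_repr' 1

end IsEuclideanForm
end JordanAlgebra
end JordanRiesz

namespace JordanRiesz

/-! ### Systems of orthogonal idempotents and spectral decompositions -/

section Systems

variable {E : Type*} [AddCommGroup E] [Module ℝ E] [Mul E] [One E]
variable {ι κ : Type*} [Fintype ι] [Fintype κ]

/-- A complete system of nonzero orthogonal idempotents. -/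
structure IsIdempotentSystem (c : ι → E) : Prop where
  idem : ∀ i, c i * c i = c i
  ne_zero : ∀ i, c i ≠ 0
  orthogonal : ∀ i j, i ≠ j → c i * c j = 0
  sum_eq_one : ∑ i, c i = 1

lemma IsJordanFrame.isIdempotentSystem {r : ℕ} {c : Fin r → E} (hc : IsJordanFrame c) :
    IsIdempotentSystem c :=
  ⟨fun i => (hc.primitive i).1, fun i => (hc.primitive i).2.1, hc.orthogonal, hc.sum_eq_one⟩

/-- A polynomial which is the indicator function of `t` on a given finite set. -/
lemma exists_indicator_polynomial (S : Finset ℝ) (t : ℝ) :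
    ∃ p : Polynomial ℝ, ∀ u ∈ S, p.eval u = if u = t then 1 else 0 := by
  classical
  refine ⟨Lagrange.interpolate S id fun u => if u = t then 1 else 0, fun u hu => ?_⟩
  exact Lagrange.eval_interpolate_at_node (v := id) _ (Set.injOn_id _) hu

namespace IsIdempotentSystem

lemma comp_equiv {c : ι → E} (hc : IsIdempotentSystem c) (e : κ ≃ ι) :
    IsIdempotentSystem (c ∘ e) :=
  ⟨fun i => hc.idem _, fun i => hc.ne_zero _,
    fun i j hij => hc.orthogonal _ _ fun h => hij (e.injective h),
    by rw [← hc.sum_eq_one]; exact e.sum_comp c⟩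

lemma mul_sum_smul {c : ι → E} (hc : IsIdempotentSystem c) (hJ : IsJordanAlgebra E) (a : ι → ℝ)
    (i : ι) : (∑ j, a j • c j) * c i = a i • c i := by
  rw [hJ.sum_mul, Finset.sum_eq_single i]
  · rw [hJ.smul_mul, hc.idem]
  · intro j _ hj
    rw [hJ.smul_mul, hc.orthogonal j i hj, smul_zero]
  · simp

lemma sum_filter_mul {c : ι → E} (hc : IsIdempotentSystem c) (hJ : IsJordanAlgebra E)
    [DecidableEq ι] (s : Finset ι) (i : ι) :
    (∑ j ∈ s, c j) * c i = if i ∈ s then c i else 0 := by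
  rw [hJ.sum_mul]
  split_ifs with h
  · rw [Finset.sum_eq_single_of_mem i h, hc.idem]
    exact fun j _ hj => hc.orthogonal j i hj
  · exact Finset.sum_eq_zero fun j hj => hc.orthogonal j i fun e => h (e ▸ hj)

lemma sum_mul_sum {c : ι → E} (hc : IsIdempotentSystem c) (hJ : IsJordanAlgebra E)
    (a b : ι → ℝ) : (∑ j, a j • c j) * (∑ j, b j • c j) = ∑ j, (a j * b j) • c j := by
  rw [hJ.mul_sum]
  refine Finset.sum_congr rfl fun i _ => ?_
  rw [hJ.mul_smul, hc.mul_sum_smul hJ, smul_smul, mul_comm]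

lemma sum_finset_idem {c : ι → E} (hc : IsIdempotentSystem c) (hJ : IsJordanAlgebra E)
    (s : Finset ι) : (∑ j ∈ s, c j) * (∑ j ∈ s, c j) = ∑ j ∈ s, c j := by
  classical
  rw [hJ.mul_sum]
  refine Finset.sum_congr rfl fun i hi => ?_
  rw [hc.sum_filter_mul hJ, if_pos hi]

lemma linearIndependent {c : ι → E} (hc : IsIdempotentSystem c) (hJ : IsJordanAlgebra E) :
    LinearIndependent ℝ c := by
  rw [Fintype.linearIndependent_iff]
  intro a ha i
  have h := hc.mul_sum_smul hJ a i
  rw [ha, hJ.zero_mul] at h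
  exact (smul_eq_zero.mp h.symm).resolve_right (hc.ne_zero i)

lemma card_le [FiniteDimensional ℝ E] {c : ι → E} (hc : IsIdempotentSystem c)
    (hJ : IsJordanAlgebra E) : Fintype.card ι ≤ Module.finrank ℝ E :=
  (hc.linearIndependent hJ).fintype_card_le_finrank

lemma eval {c : ι → E} (hc : IsIdempotentSystem c) (hJ : IsJordanAlgebra E) (a : ι → ℝ)
    (p : Polynomial ℝ) : hJ.eval (∑ i, a i • c i) p = ∑ i, p.eval (a i) • c i :=
  hJ.eval_eq_sum (fun i => hc.mul_sum_smul hJ a i) hc.sum_eq_one p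

/-- The spectral idempotents of an element are determined by the element. -/
lemma spectral_unique {c : ι → E} {d : κ → E} (hc : IsIdempotentSystem c)
    (hd : IsIdempotentSystem d) (hJ : IsJordanAlgebra E) {a : ι → ℝ} {b : κ → ℝ}
    (h : ∑ i, a i • c i = ∑ j, b j • d j) (t : ℝ) :
    ∑ i with a i = t, c i = ∑ j with b j = t, d j := by
  classical
  obtain ⟨p, hp⟩ := exists_indicator_polynomial (Finset.univ.image a ∪ Finset.univ.image b) t
  have h1 := hc.eval hJ a p
  rw [h, hd.eval hJ b p] at h1
  have ha : ∀ i, p.eval (a i) = if a i = t then 1 else 0 := fun i => hp _ (by simp)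
  have hb : ∀ i, p.eval (b i) = if b i = t then 1 else 0 := fun i => hp _ (by simp)
  simp only [ha, hb, ite_smul, one_smul, zero_smul] at h1
  rw [Finset.sum_filter, Finset.sum_filter, h1]

/-- Squaring `p + q` gives `pq = 0`. For `j ≠ i`, `p + q` annihilates `c j`, and positivity of
multiplication by idempotents forces `p` and `q` to do so separately. -/
lemma split {c : ι → E} (hc : IsIdempotentSystem c) (hJ : IsJordanAlgebra E)
    {B : LinearMap.BilinForm ℝ E} (hB : IsEuclideanForm B) [DecidableEq ι] {i : ι} {p q : E}
    (hp : p * p = p) (hq : q * q = q) (hp0 : p ≠ 0) (hq0 : q ≠ 0) (h : c i = p + q) :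
    IsIdempotentSystem (fun o : Option ι => o.elim p (Function.update c i q)) := by
  have hpq : p * q = 0 := by
    have h1 := hc.idem i
    rw [h, hJ.add_mul, hJ.mul_add, hJ.mul_add, hp, hq, hJ.mul_comm q p] at h1
    have h2 : (2 : ℝ) • (p * q) = 0 := by
      linear_combination (norm := module) h1
    exact (smul_eq_zero.mp h2).resolve_left two_ne_zero
  have hort : ∀ j, j ≠ i → p * c j = 0 ∧ q * c j = 0 := by
    intro j hj
    have hs : (∑ k : Bool, (fun k => if k then p else q) k) * c j = 0 := by
      simp [← h, hc.orthogonal i j hj.symm]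
    have hi : ∀ k ∈ (Finset.univ : Finset Bool), (fun k => if k then p else q) k *
        (fun k => if k then p else q) k = (fun k => if k then p else q) k := by
      intro k _; cases k <;> simp [hp, hq]
    exact ⟨by simpa using hB.mul_eq_zero_of_sum hJ hi hs (Finset.mem_univ true),
      by simpa using hB.mul_eq_zero_of_sum hJ hi hs (Finset.mem_univ false)⟩
  refine ⟨?_, ?_, ?_, ?_⟩
  · rintro (_ | j)
    · exact hp
    · by_cases hj : j = i
      · subst hj; simpa using hq
      · simpa [hj] using hc.idem j
  · rintro (_ | j)
    · exact hp0
    · by_cases hj : j = i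
      · subst hj; simpa using hq0
      · simpa [hj] using hc.ne_zero j
  · rintro (_ | j) (_ | k) hjk
    · exact absurd rfl hjk
    · by_cases hk : k = i
      · subst hk; simpa using hpq
      · simpa [hk] using (hort k hk).1
    · rw [hJ.mul_comm]
      by_cases hj : j = i
      · subst hj; simpa using hpq
      · simpa [hj] using (hort j hj).1
    · have hjk' : j ≠ k := fun e => hjk (by rw [e])
      by_cases hj : j = i
      · subst hj
        simpa [hjk'.symm] using (hort k hjk'.symm).2
      · by_cases hk : k = i
        · subst hk
          rw [hJ.mul_comm]
          simpa [hj] using (hort j hj).2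
        · simpa [hj, hk] using hc.orthogonal j k hjk'
  · rw [Fintype.sum_option]
    simp only [Option.elim]
    rw [Finset.sum_update_of_mem (Finset.mem_univ i), ← hc.sum_eq_one,
      ← Finset.add_sum_erase _ _ (Finset.mem_univ i), h, Finset.sdiff_singleton_eq_erase, add_assoc]

end IsIdempotentSystem

/-- The component of `1` in the `t`-eigenspace of `L(x)` is `p(x)` for an interpolating indicator
polynomial `p`. So these components multiply like indicator functions; the nonzero ones form the
system. -/
lemma exists_system [FiniteDimensional ℝ E] (hJ : IsJordanAlgebra E)
    {B : LinearMap.BilinForm ℝ E} (hB : IsEuclideanForm B) (x : E) :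
    ∃ (k : ℕ) (c : Fin k → E) (a : Fin k → ℝ), IsIdempotentSystem c ∧ x = ∑ i, a i • c i := by
  classical
  obtain ⟨n, w, a, hw, h1⟩ := hB.exists_eigen_decomposition hJ x
  have hx : x = ∑ i, a i • w i := by
    conv_lhs => rw [← hJ.mul_one x, ← h1, hJ.mul_sum]
    exact Finset.sum_congr rfl fun i _ => hw i
  let v : ℝ → E := fun t => ∑ i with a i = t, w i
  have hv : ∀ t u, v t * v u = if t = u then v t else 0 := by
    intro t u
    obtain ⟨p, hp⟩ := exists_indicator_polynomial (Finset.univ.image a) t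
    obtain ⟨q, hq⟩ := exists_indicator_polynomial (Finset.univ.image a) u
    have ha : ∀ i, p.eval (a i) = if a i = t then 1 else 0 := fun i => hp _ (by simp)
    have hb : ∀ i, q.eval (a i) = if a i = u then 1 else 0 := fun i => hq _ (by simp)
    have e1 : hJ.eval x p = v t := by
      rw [hJ.eval_eq_sum hw h1]; simp [ha, v, Finset.sum_filter]
    have e2 : hJ.eval x q = v u := by
      rw [hJ.eval_eq_sum hw h1]; simp [hb, v, Finset.sum_filter]
    rw [← e1, ← e2, hJ.eval_mul_eval, hJ.eval_eq_sum hw h1]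
    split_ifs with htu
    · subst htu
      rw [hJ.eval_eq_sum hw h1]
      refine Finset.sum_congr rfl fun i _ => ?_
      rw [Polynomial.eval_mul, ha, hb]; split_ifs <;> simp
    · refine Finset.sum_eq_zero fun i _ => ?_
      rw [Polynomial.eval_mul, ha, hb]
      by_cases h : a i = t
      · have : a i ≠ u := fun e => htu (h.symm.trans e)
        simp [this]
      · simp [h]
  let S : Finset ℝ := (Finset.univ.image a).filter fun t => v t ≠ 0
  have hsum : ∀ f : ℝ → ℝ, ∑ t : S, f t • v t = ∑ i, f (a i) • w i := by
    intro f
    rw [Finset.sum_coe_sort S fun t => f t • v t, Finset.sum_filter_of_ne,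
      ← Finset.sum_fiberwise_of_maps_to (s := Finset.univ) (t := Finset.univ.image a) (g := a)]
    · refine Finset.sum_congr rfl fun t _ => ?_
      rw [Finset.smul_sum]
      refine Finset.sum_congr rfl fun i hi => ?_
      rw [(Finset.mem_filter.mp hi).2]
    · intro i hi; simp
    · intro t _ ht h0
      exact ht (by rw [h0, smul_zero])
  have hc : IsIdempotentSystem fun t : S => v t := by
    refine ⟨fun t => by simp [hv], fun t => (Finset.mem_filter.mp t.2).2, fun t u htu => ?_, ?_⟩
    · rw [hv, if_neg fun h => htu (Subtype.ext h)]
    · simpa [h1] using hsum fun _ => 1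
  refine ⟨_, _, fun i => (S.equivFin.symm i : ℝ), hc.comp_equiv S.equivFin.symm, ?_⟩
  rw [hx, ← hsum fun t => t]
  exact (S.equivFin.symm.sum_comp fun t : S => (t : ℝ) • v t).symm

/-- Every element has a spectral decomposition with respect to a Jordan frame that is at least as
large as any system of idempotents whose span contains the element. -/
lemma exists_frame_of_max [FiniteDimensional ℝ E] (hJ : IsJordanAlgebra E)
    {B : LinearMap.BilinForm ℝ E} (hB : IsEuclideanForm B) (x : E) :
    ∃ (k : ℕ) (c : Fin k → E) (a : Fin k → ℝ), IsJordanFrame c ∧ x = ∑ i, a i • c i ∧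
      ∀ (m : ℕ) (d : Fin m → E) (b : Fin m → ℝ), IsIdempotentSystem d → x = ∑ i, b i • d i →
        m ≤ k := by
  classical
  let P : ℕ → Prop := fun k => ∃ (c : Fin k → E) (a : Fin k → ℝ),
    IsIdempotentSystem c ∧ x = ∑ i, a i • c i
  have hbd : ∀ k, P k → k ≤ Module.finrank ℝ E := by
    rintro k ⟨c, a, hc, -⟩
    simpa using hc.card_le hJ
  obtain ⟨k₀, c₀, a₀, h₀⟩ := exists_system hJ hB x
  have hk₀ : P k₀ := ⟨c₀, a₀, h₀⟩
  -- A system of maximal size whose span contains `x`. If a member were not primitive, splitting it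
  -- would give a larger one, with `x` still in the span.
  set k := Nat.findGreatest P (Module.finrank ℝ E) with hk
  obtain ⟨c, a, hc, hx⟩ : P k := Nat.findGreatest_spec (hbd k₀ hk₀) hk₀
  have hmax : ∀ m, P m → m ≤ k := fun m hm => Nat.le_findGreatest (hbd m hm) hm
  refine ⟨k, c, a, ⟨fun i => ⟨hc.idem i, hc.ne_zero i, ?_⟩, hc.orthogonal, hc.sum_eq_one⟩, hx,
    fun m d b hd hb => hmax m ⟨d, b, hd, hb⟩⟩
  rintro ⟨p, q, hp, hq, hp0, hq0, hpq⟩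
  have hs := hc.split hJ hB hp hq hp0 hq0 hpq
  have : P (k + 1) := by
    let e := (Fintype.equivFinOfCardEq (by simp : Fintype.card (Option (Fin k)) = k + 1)).symm
    refine ⟨_, (fun o : Option (Fin k) => o.elim (a i) a) ∘ e, hs.comp_equiv e, ?_⟩
    have := e.sum_comp fun o : Option (Fin k) => (o.elim (a i) a) •
      (o.elim p (Function.update c i q))
    refine Eq.trans ?_ this.symm
    rw [Fintype.sum_option]
    simp only [Option.elim]
    have e2 : ∀ j, a j • Function.update c i q j =
        Function.update (fun j => a j • c j) i (a i • q) j := by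
      intro j
      by_cases hj : j = i
      · subst hj; simp
      · simp [hj]
    simp only [e2]
    rw [Finset.sum_update_of_mem (Finset.mem_univ i), hx,
      ← Finset.add_sum_erase _ _ (Finset.mem_univ i), hpq, Finset.sdiff_singleton_eq_erase,
      smul_add, add_assoc]
  have := hmax _ this
  omega

/-- A primitive idempotent is not a sum of several members of a system of idempotents. -/
lemma IsPrimitiveIdempotent.eq_of_sum {c : E} (hc : IsPrimitiveIdempotent c)
    (hJ : IsJordanAlgebra E) {d : ι → E} (hd : IsIdempotentSystem d) {s : Finset ι}
    (h : c = ∑ i ∈ s, d i) {i j : ι} (hi : i ∈ s) (hj : j ∈ s) : i = j := by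
  classical
  by_contra hij
  refine hc.2.2 ⟨d i, ∑ k ∈ s.erase i, d k, hd.idem i, hd.sum_finset_idem hJ _, hd.ne_zero i, ?_, ?_⟩
  · intro h0
    have := hd.sum_filter_mul hJ (s.erase i) j
    rw [h0, hJ.zero_mul, if_pos (Finset.mem_erase.mpr ⟨fun e => hij e.symm, hj⟩)] at this
    exact hd.ne_zero j this.symm
  · rw [h, Finset.add_sum_erase _ _ hi]

/-- As the `b j` are distinct, the spectral idempotents of the element are the `c j`. Each is a sum
of members of `d`, and primitivity leaves room for only one. -/
lemma card_le_card_of_primitive (hJ : IsJordanAlgebra E) {c : κ → E} {d : ι → E}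
    (hc : IsIdempotentSystem c) (hp : ∀ j, IsPrimitiveIdempotent (c j))
    (hd : IsIdempotentSystem d) {a : ι → ℝ} {b : κ → ℝ} (hb : Function.Injective b)
    (h : ∑ i, a i • d i = ∑ j, b j • c j) : Fintype.card ι ≤ Fintype.card κ := by
  classical
  have key := hd.spectral_unique hc hJ h
  have h1 : ∀ i, ∃ j, b j = a i := by
    intro i
    by_contra! hne
    have h2 := key (a i)
    rw [Finset.filter_eq_empty_iff.mpr (fun j _ => hne j), Finset.sum_empty] at h2
    have h3 := hd.sum_filter_mul hJ (Finset.univ.filter fun k => a k = a i) i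
    rw [h2, hJ.zero_mul, if_pos (by simp)] at h3
    exact hd.ne_zero i h3.symm
  choose f hf using h1
  refine Fintype.card_le_of_injective f fun i i' hii => ?_
  have ha : a i = a i' := by rw [← hf i, ← hf i', hii]
  have h2 := key (a i)
  have h3 : (Finset.univ.filter fun j => b j = a i) = {f i} := by
    ext j
    simp only [Finset.mem_filter, Finset.mem_univ, true_and, Finset.mem_singleton, ← hf i]
    exact hb.eq_iff
  rw [h3, Finset.sum_singleton] at h2
  exact (hp (f i)).eq_of_sum hJ hd h2.symm (by simp) (by simp [ha])

/-- Both decompositions share the spectral idempotent at `t`, so its part in one can be exchanged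
for its part in the other. This allows multiplicities to be compared by counting. -/
lemma isIdempotentSystem_mix (hJ : IsJordanAlgebra E) {B : LinearMap.BilinForm ℝ E}
    (hB : IsEuclideanForm B) {c : ι → E} {d : κ → E} (hc : IsIdempotentSystem c)
    (hd : IsIdempotentSystem d) {a : ι → ℝ} {b : κ → ℝ}
    (h : ∑ i, a i • c i = ∑ j, b j • d j) (t : ℝ) :
    IsIdempotentSystem (Sum.elim (fun i : {i // a i = t} => c i) (fun j : {j // b j ≠ t} => d j)) := by
  classical
  have key := hc.spectral_unique hd hJ h t
  have hort : ∀ i j, a i = t → b j ≠ t → c i * d j = 0 := by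
    intro i j hi hj
    refine hB.mul_eq_zero_of_sum hJ (s := Finset.univ.filter fun i => a i = t)
      (fun i _ => hc.idem i) ?_ (by simp [hi])
    rw [key, hd.sum_filter_mul hJ, if_neg (by simp [hj])]
  refine ⟨?_, ?_, ?_, ?_⟩
  · rintro (i | j)
    exacts [hc.idem _, hd.idem _]
  · rintro (i | j)
    exacts [hc.ne_zero _, hd.ne_zero _]
  · rintro (i | j) (i' | j') hij
    · exact hc.orthogonal _ _ fun e => hij (congrArg Sum.inl (Subtype.ext e))
    · exact hort _ _ i.2 j'.2
    · exact (hJ.mul_comm _ _).trans (hort _ _ i'.2 j.2)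
    · exact hd.orthogonal _ _ fun e => hij (congrArg Sum.inr (Subtype.ext e))
  · rw [Fintype.sum_sum_type]
    simp only [Sum.elim_inl, Sum.elim_inr]
    rw [← Finset.sum_subtype (Finset.univ.filter fun i => a i = t) (by simp) c,
      ← Finset.sum_subtype (Finset.univ.filter fun j => b j ≠ t) (by simp) d,
      key, Finset.sum_filter_add_sum_filter_not, hd.sum_eq_one]

end Systems
end JordanRiesz

namespace JordanRiesz

/-! ### Density of regular elements, compactness, and the size of Jordan frames -/

section Topology

variable {E : Type*} [NormedAddCommGroup E] [NormedSpace ℝ E] [FiniteDimensional ℝ E]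
  [Mul E] [One E]

open Filter Topology

namespace IsJordanAlgebra

/-- The product as a continuous bilinear map. -/
noncomputable def clmul (hJ : IsJordanAlgebra E) : E →L[ℝ] E →L[ℝ] E :=
  LinearMap.toContinuousLinearMap
    ((LinearMap.toContinuousLinearMap : (E →ₗ[ℝ] E) ≃ₗ[ℝ] (E →L[ℝ] E)).toLinearMap ∘ₗ hJ.lmul)

lemma continuous_mul (hJ : IsJordanAlgebra E) : Continuous fun p : E × E => p.1 * p.2 :=
  hJ.clmul.continuous₂

lemma exists_mul_bound (hJ : IsJordanAlgebra E) :
    ∃ M : ℝ, 0 < M ∧ ∀ x y : E, ‖x * y‖ ≤ M * ‖x‖ * ‖y‖ := by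
  refine ⟨‖hJ.clmul‖ + 1, by positivity, fun x y => ?_⟩
  refine (hJ.clmul.le_opNorm₂ x y).trans ?_
  gcongr
  linarith

/-- On the line from `x` to `y`, a minor of the matrix of coordinates of the powers is analytic in
the parameter and equals `1` at `y`. So it cannot vanish identically near `x`. -/
lemma exists_pow_linearIndependent (hJ : IsJordanAlgebra E) {r : ℕ} {y : E}
    (hy : LinearIndependent ℝ fun j : Fin r => hJ.pow y j) (x : E) :
    ∃ z : ℕ → E, Tendsto z atTop (𝓝 x) ∧
      ∀ n, LinearIndependent ℝ fun j : Fin r => hJ.pow (z n) j := by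
  classical
  let z : ℝ → E := fun t => x + t • (y - x)
  have hz : ∀ t, AnalyticAt ℝ z t := fun t =>
    analyticAt_const.add (analyticAt_id.smul analyticAt_const)
  have hp : ∀ j t, AnalyticAt ℝ (fun t => hJ.pow (z t) j) t := by
    intro j t
    induction j with
    | zero => exact analyticAt_const
    | succ j ih =>
      simp only [hJ.pow_succ]
      exact (hJ.clmul.analyticAt_bilinear (z t, hJ.pow (z t) j)).comp₂ (hz t) ih
  obtain ⟨g, hg⟩ := (Fintype.linearCombination ℝ fun j : Fin r => hJ.pow y j).exists_leftInverse_of_injective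
    (LinearMap.ker_eq_bot.mpr hy.fintypeLinearCombination_injective)
  let gc : E →L[ℝ] (Fin r → ℝ) := LinearMap.toContinuousLinearMap g
  let A : ℝ → Matrix (Fin r) (Fin r) ℝ := fun t => Matrix.of fun i j => gc (hJ.pow (z t) j) i
  have hA : AnalyticOnNhd ℝ (fun t => (A t).det) Set.univ := by
    intro t _
    simp only [Matrix.det_apply]
    refine Finset.analyticAt_fun_sum _ fun σ _ => ?_
    refine AnalyticAt.const_smul (Finset.analyticAt_fun_prod _ fun i _ => ?_)
    have h1 : AnalyticAt ℝ (fun t => gc (hJ.pow (z t) i)) t := (gc.analyticAt _).comp (hp i t)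
    exact ((ContinuousLinearMap.proj (R := ℝ) (φ := fun _ : Fin r => ℝ) (σ i)).analyticAt _).comp h1
  have hA1 : A 1 = 1 := by
    ext i j
    have h1 := congrArg (fun T => T (Pi.single j 1) i) hg
    simp only [LinearMap.comp_apply, LinearMap.id_apply,
      Fintype.linearCombination_apply_single, one_smul] at h1
    have : z 1 = y := by simp [z]
    simp only [A, Matrix.of_apply, this]
    rw [Matrix.one_apply]
    refine h1.trans ?_
    simp [Pi.single_apply]
  have hLI : ∀ t, (A t).det ≠ 0 → LinearIndependent ℝ fun j : Fin r => hJ.pow (z t) j := by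
    intro t ht
    rw [Fintype.linearIndependent_iff]
    intro v hv i
    refine congrFun (Matrix.eq_zero_of_mulVec_eq_zero ht (v := v) ?_) i
    ext k
    have h1 := congrFun (congrArg gc hv) k
    simp only [map_sum, map_smul, map_zero, Finset.sum_apply, Pi.smul_apply, smul_eq_mul] at h1
    change ∑ j : Fin r, gc (hJ.pow (z t) j) k * v j = 0
    refine Eq.trans (Finset.sum_congr rfl fun j _ => _root_.mul_comm _ _) h1
  have hfreq : ∃ᶠ t in 𝓝 (0 : ℝ), (A t).det ≠ 0 := by
    intro hev
    have := hA.eqOn_zero_of_preconnected_of_eventuallyEq_zero isPreconnected_univ (Set.mem_univ 0)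
      (hev.mono fun t ht => not_not.mp ht)
    have h1 := this (Set.mem_univ 1)
    simp [hA1] at h1
  obtain ⟨t, ht0, ht⟩ := exists_seq_forall_of_frequently hfreq
  refine ⟨fun n => z (t n), ?_, fun n => hLI _ (ht n)⟩
  have : z 0 = x := by simp [z]
  rw [← this]
  exact ((hz 0).continuousAt.tendsto).comp ht0

end IsJordanAlgebra

/-- For an idempotent `B(c, c) = B(c, 1)`: the left side grows quadratically in `‖c‖`, the right
side at most linearly. -/
lemma IsEuclideanForm.exists_idem_bound {B : LinearMap.BilinForm ℝ E} (hB : IsEuclideanForm B)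
    (hJ : IsJordanAlgebra E) : ∃ R : ℝ, 0 < R ∧ ∀ c : E, c * c = c → ‖c‖ ≤ R := by
  let Bc : E →L[ℝ] E →L[ℝ] ℝ := LinearMap.toContinuousLinearMap
    ((LinearMap.toContinuousLinearMap : (E →ₗ[ℝ] ℝ) ≃ₗ[ℝ] (E →L[ℝ] ℝ)).toLinearMap ∘ₗ B)
  have hBc : ∀ x y, Bc x y = B x y := fun _ _ => rfl
  obtain ⟨m, hm, hmB⟩ : ∃ m : ℝ, 0 < m ∧ ∀ x : E, m * ‖x‖ ^ 2 ≤ B x x := by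
    rcases (Metric.sphere (0 : E) 1).eq_empty_or_nonempty with h | h
    · refine ⟨1, one_pos, fun x => ?_⟩
      by_cases hx : x = 0
      · simp [hx]
      · have : ‖x‖⁻¹ • x ∈ Metric.sphere (0 : E) 1 := by simp [norm_smul, hx]
        simp [h] at this
    · have hcont : Continuous fun x => Bc x x :=
        Bc.continuous₂.comp (continuous_id.prodMk continuous_id)
      obtain ⟨x₀, hx₀, hmin⟩ := (isCompact_sphere (0 : E) 1).exists_isMinOn h hcont.continuousOn
      have hx0 : x₀ ≠ 0 := by
        rintro rfl
        simp at hx₀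
      refine ⟨B x₀ x₀, hB.pos _ hx0, fun x => ?_⟩
      by_cases hx : x = 0
      · simp [hx]
      · have hn : ‖x‖ ≠ 0 := norm_ne_zero_iff.mpr hx
        have h1 : B x₀ x₀ ≤ B (‖x‖⁻¹ • x) (‖x‖⁻¹ • x) :=
          isMinOn_iff.mp hmin _ (by simp [norm_smul, hx])
        simp only [map_smul, LinearMap.smul_apply, smul_eq_mul] at h1
        calc B x₀ x₀ * ‖x‖ ^ 2 ≤ (‖x‖⁻¹ * (‖x‖⁻¹ * B x x)) * ‖x‖ ^ 2 := by gcongr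
          _ = B x x := by field_simp
  refine ⟨‖Bc‖ * ‖(1 : E)‖ / m + 1, by positivity, fun c hc => ?_⟩
  have h1 : B c c ≤ ‖Bc‖ * ‖c‖ * ‖(1 : E)‖ := by
    have : B c c = Bc c 1 := by
      have h := hB.assoc c c 1
      rw [hc, hJ.mul_one] at h
      exact h.symm
    rw [this]
    exact (le_abs_self _).trans (Bc.le_opNorm₂ c 1)
  have h2 := (hmB c).trans h1
  by_cases h0 : ‖c‖ = 0
  · rw [h0]; positivity
  · have hpos : 0 < ‖c‖ := lt_of_le_of_ne (norm_nonneg _) (Ne.symm h0)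
    have h3 : ‖c‖ * m ≤ ‖Bc‖ * ‖(1 : E)‖ := by
      refine le_of_mul_le_mul_right ?_ hpos
      nlinarith
    have := (le_div_iff₀ hm).mpr h3
    linarith

/-- Replaces `c ≠ 0` by a closed condition, so that limits of systems of idempotents are again such
systems. -/
lemma one_le_norm_idem {M : ℝ} (hM : ∀ x y : E, ‖x * y‖ ≤ M * ‖x‖ * ‖y‖) {c : E}
    (hc : c * c = c) (h0 : c ≠ 0) : 1 ≤ M * ‖c‖ := by
  have h := hM c c
  rw [hc] at h
  have hpos : 0 < ‖c‖ := norm_pos_iff.mpr h0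
  exact le_of_mul_le_mul_right (by simpa using h) hpos

lemma IsIdempotentSystem.abs_coeff_le {ι : Type*} [Fintype ι] (hJ : IsJordanAlgebra E) {M : ℝ}
    (hM : ∀ x y : E, ‖x * y‖ ≤ M * ‖x‖ * ‖y‖) {c : ι → E} (hc : IsIdempotentSystem c)
    (a : ι → ℝ) (i : ι) : |a i| ≤ M * ‖∑ j, a j • c j‖ := by
  have h := hM (∑ j, a j • c j) (c i)
  rw [hc.mul_sum_smul hJ, norm_smul, Real.norm_eq_abs] at h
  exact le_of_mul_le_mul_right h (norm_pos_iff.mpr (hc.ne_zero i))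

lemma isCompact_systems (hJ : IsJordanAlgebra E) {B : LinearMap.BilinForm ℝ E}
    (hB : IsEuclideanForm B) (r : ℕ) : IsCompact {c : Fin r → E | IsIdempotentSystem c} := by
  obtain ⟨R, hR, hRc⟩ := hB.exists_idem_bound hJ
  obtain ⟨M, hM, hMc⟩ := hJ.exists_mul_bound
  have hmul : ∀ f g : (Fin r → E) → E, Continuous f → Continuous g →
      Continuous fun c => f c * g c := fun f g hf hg => hJ.continuous_mul.comp (hf.prodMk hg)
  have heq : {c : Fin r → E | IsIdempotentSystem c} =
      (⋂ i, {c | c i * c i = c i}) ∩ (⋂ i, {c | 1 ≤ M * ‖c i‖}) ∩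
        (⋂ i, ⋂ j, ⋂ _ : i ≠ j, {c | c i * c j = 0}) ∩ {c | ∑ i, c i = 1} := by
    ext c
    simp only [Set.mem_ofPred_eq, Set.mem_inter_iff, Set.mem_iInter]
    constructor
    · intro hc
      exact ⟨⟨⟨hc.idem, fun i => one_le_norm_idem hMc (hc.idem i) (hc.ne_zero i)⟩,
        hc.orthogonal⟩, hc.sum_eq_one⟩
    · rintro ⟨⟨⟨h1, h2⟩, h3⟩, h4⟩
      refine ⟨h1, fun i h0 => ?_, h3, h4⟩
      have := h2 i
      rw [h0] at this
      norm_num at this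
  refine Metric.isCompact_of_isClosed_isBounded ?_ ?_
  · rw [heq]
    refine (((isClosed_iInter fun i => ?_).inter (isClosed_iInter fun i => ?_)).inter
      (isClosed_iInter fun i => isClosed_iInter fun j => isClosed_iInter fun _ => ?_)).inter ?_
    · exact isClosed_eq (hmul _ _ (continuous_apply i) (continuous_apply i)) (continuous_apply i)
    · exact isClosed_le continuous_const (continuous_const.mul (continuous_apply i).norm)
    · exact isClosed_eq (hmul _ _ (continuous_apply i) (continuous_apply j)) continuous_const
    · exact isClosed_eq (continuous_finsetSum _ fun i _ => continuous_apply i) continuous_const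
  · refine (Metric.isBounded_closedBall (x := (0 : Fin r → E)) (r := R)).subset fun c hc => ?_
    rw [mem_closedBall_zero_iff, pi_norm_le_iff_of_nonneg hR.le]
    exact fun i => hRc _ (hc.idem i)

/-- Spectral decompositions along a convergent sequence have a convergent subsequence. -/
lemma exists_subseq_decomposition (hJ : IsJordanAlgebra E) {B : LinearMap.BilinForm ℝ E}
    (hB : IsEuclideanForm B) {r : ℕ} {x : ℕ → E} {x₀ : E} (hx : Tendsto x atTop (𝓝 x₀))
    {c : ℕ → Fin r → E} {a : ℕ → Fin r → ℝ} (hc : ∀ n, IsIdempotentSystem (c n))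
    (hxa : ∀ n, x n = ∑ i, a n i • c n i) :
    ∃ (φ : ℕ → ℕ) (c₀ : Fin r → E) (a₀ : Fin r → ℝ), StrictMono φ ∧ IsIdempotentSystem c₀ ∧
      Tendsto (a ∘ φ) atTop (𝓝 a₀) ∧ x₀ = ∑ i, a₀ i • c₀ i := by
  obtain ⟨M, hM, hMc⟩ := hJ.exists_mul_bound
  obtain ⟨K, hK⟩ := hx.norm.bddAbove_range
  have hK' : ∀ n, ‖x n‖ ≤ K := fun n => hK ⟨n, rfl⟩
  have hK0 : 0 ≤ K := (norm_nonneg _).trans (hK' 0)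
  have hmem : ∀ n, (c n, a n) ∈ {c : Fin r → E | IsIdempotentSystem c} ×ˢ
      Metric.closedBall (0 : Fin r → ℝ) (M * K) := by
    refine fun n => ⟨hc n, ?_⟩
    rw [mem_closedBall_zero_iff, pi_norm_le_iff_of_nonneg (by positivity)]
    intro i
    refine ((hc n).abs_coeff_le hJ hMc (a n) i).trans ?_
    rw [← hxa]
    exact mul_le_mul_of_nonneg_left (hK' n) hM.le
  obtain ⟨⟨c₀, a₀⟩, h₀, φ, hφ, hlim⟩ :=
    ((isCompact_systems hJ hB r).prod (isCompact_closedBall _ _)).tendsto_subseq hmem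
  have hlc : Tendsto (c ∘ φ) atTop (𝓝 c₀) := (continuous_fst.tendsto _).comp hlim
  have hla : Tendsto (a ∘ φ) atTop (𝓝 a₀) := (continuous_snd.tendsto _).comp hlim
  refine ⟨φ, c₀, a₀, hφ, h₀.1, hla, ?_⟩
  refine tendsto_nhds_unique (hx.comp hφ.tendsto_atTop) ?_
  have : x ∘ φ = fun n => ∑ i, (a ∘ φ) n i • (c ∘ φ) n i := funext fun n => hxa _
  rw [this]
  exact tendsto_finsetSum _ fun i _ =>
    (tendsto_pi_nhds.mp hla i).smul (tendsto_pi_nhds.mp hlc i)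

/-- A Jordan frame is at least as large as any system of idempotents. -/
lemma IsJordanFrame.card_system_le (hJ : IsJordanAlgebra E) {B : LinearMap.BilinForm ℝ E}
    (hB : IsEuclideanForm B) {k : ℕ} {c : Fin k → E} (hc : IsJordanFrame c) {ι : Type*} [Fintype ι]
    {d : ι → E} (hd : IsIdempotentSystem d) : Fintype.card ι ≤ k := by
  classical
  let P : ℕ → Prop := fun k => ∃ c : Fin k → E, IsIdempotentSystem c
  have hbd : ∀ k, P k → k ≤ Module.finrank ℝ E := by
    rintro k ⟨c, hc⟩
    simpa using hc.card_le hJ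
  have hPd : P (Fintype.card ι) := ⟨_, hd.comp_equiv (Fintype.equivFin ι).symm⟩
  set r := Nat.findGreatest P (Module.finrank ℝ E) with hr
  obtain ⟨d', hd'⟩ : P r := Nat.findGreatest_spec (hbd _ hPd) hPd
  have hmax : ∀ m, P m → m ≤ r := fun m hm => Nat.le_findGreatest (hbd m hm) hm
  refine (hmax _ hPd).trans ?_
  have hpow : ∀ (k : ℕ) (c : Fin k → E) (a : Fin k → ℝ), IsIdempotentSystem c → ∀ j : ℕ,
      hJ.pow (∑ i, a i • c i) j = ∑ i, a i ^ j • c i := by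
    intro k c a hc j
    have := hc.eval hJ a (Polynomial.X ^ j)
    simpa [IsJordanAlgebra.eval, IsJordanAlgebra.pow] using this
  -- An element with `r` distinct coefficients has `r` independent powers, by Vandermonde.
  have hy : LinearIndependent ℝ fun j : Fin r =>
      hJ.pow (∑ i : Fin r, ((i : ℕ) : ℝ) • d' i) j := by
    rw [Fintype.linearIndependent_iff]
    intro v hv
    suffices v = 0 from fun i => congrFun this i
    refine Matrix.eq_zero_of_forall_index_sum_pow_mul_eq_zero
      (f := fun i : Fin r => ((i : ℕ) : ℝ)) (fun i j h => Fin.ext (Nat.cast_injective h)) fun i => ?_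
    have h1 : ∑ i : Fin r, (∑ j : Fin r, ((i : ℕ) : ℝ) ^ (j : ℕ) * v j) • d' i = 0 := by
      rw [← hv]
      simp only [hpow _ _ _ hd', Finset.smul_sum, Finset.sum_smul, smul_smul]
      rw [Finset.sum_comm]
      exact Finset.sum_congr rfl fun _ _ => Finset.sum_congr rfl fun _ _ => by rw [mul_comm]
    exact Fintype.linearIndependent_iff.mp (hd'.linearIndependent hJ) _ h1 i
  obtain ⟨z, hz, hzL⟩ := hJ.exists_pow_linearIndependent hy (∑ i : Fin k, ((i : ℕ) : ℝ) • c i)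
  -- The `r` independent powers of `z n` lie in the span of any system that decomposes it, so that
  -- system has at least `r` members; maximality gives exactly `r`.
  have hdec : ∀ n, ∃ (c : Fin r → E) (a : Fin r → ℝ), IsIdempotentSystem c ∧
      z n = ∑ i, a i • c i := by
    intro n
    obtain ⟨m, c, a, hc, hza⟩ := exists_system hJ hB (z n)
    have hrm : r ≤ m := by
      have h1 := finrank_span_eq_card (hzL n)
      have h2 : Submodule.span ℝ (Set.range fun j : Fin r => hJ.pow (z n) j) ≤
          Submodule.span ℝ (Set.range c) := by
        rw [Submodule.span_le]
        rintro _ ⟨j, rfl⟩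
        simp only [hza, hpow _ _ _ hc]
        exact Submodule.sum_mem _ fun i _ =>
          Submodule.smul_mem _ _ (Submodule.subset_span ⟨i, rfl⟩)
      have h3 := (Submodule.finrank_mono h2).trans (finrank_range_le_card c)
      rw [h1] at h3
      simpa using h3
    obtain rfl : m = r := le_antisymm (hmax m ⟨c, hc⟩) hrm
    exact ⟨c, a, hc, hza⟩
  choose C A hC hA using hdec
  -- In the limit, `∑ i cᵢ` is decomposed along a system of `r` idempotents, while its coefficients
  -- on the primitive `cᵢ` are distinct; hence `r ≤ k`.
  obtain ⟨-, c₀, a₀, -, hc₀, -, h₀⟩ := exists_subseq_decomposition hJ hB hz hC hA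
  simpa using card_le_card_of_primitive hJ hc.isIdempotentSystem hc.primitive hc₀
    (fun i j h => Fin.ext (Nat.cast_injective h)) h₀.symm

end Topology
end JordanRiesz

namespace JordanRiesz

/-! ### Spectral values, invertible elements and the open cone -/

section SpectralValues

variable {E : Type*} [NormedAddCommGroup E] [NormedSpace ℝ E] [FiniteDimensional ℝ E]
  [Mul E] [One E]

open Filter Topology

lemma IsJordanFrame.card_eq (hJ : IsJordanAlgebra E) {B : LinearMap.BilinForm ℝ E}
    (hB : IsEuclideanForm B) {k m : ℕ} {c : Fin k → E} {d : Fin m → E} (hc : IsJordanFrame c)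
    (hd : IsJordanFrame d) : k = m :=
  le_antisymm (by simpa using hd.card_system_le hJ hB hc.isIdempotentSystem)
    (by simpa using hc.card_system_le hJ hB hd.isIdempotentSystem)

lemma IsJordanFrame.rank_eq (hJ : IsJordanAlgebra E) {B : LinearMap.BilinForm ℝ E}
    (hB : IsEuclideanForm B) {k : ℕ} {c : Fin k → E} (hc : IsJordanFrame c) : rank E = k := by
  obtain ⟨d, hd⟩ : rank E ∈ {r : ℕ | ∃ c : Fin r → E, IsJordanFrame c} := Nat.sInf_mem ⟨k, c, hc⟩
  exact hd.card_eq hJ hB hc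

lemma exists_frame (hJ : IsJordanAlgebra E) {B : LinearMap.BilinForm ℝ E}
    (hB : IsEuclideanForm B) (x : E) :
    ∃ (c : Fin (rank E) → E) (a : Fin (rank E) → ℝ), IsJordanFrame c ∧ x = ∑ i, a i • c i := by
  obtain ⟨k, c, a, hc, hx, -⟩ := exists_frame_of_max hJ hB x
  obtain rfl := hc.rank_eq hJ hB
  exact ⟨c, a, hc, hx⟩

/-- A system of idempotents with as many members as the rank is a Jordan frame. -/
lemma IsIdempotentSystem.isJordanFrame (hJ : IsJordanAlgebra E) {B : LinearMap.BilinForm ℝ E}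
    (hB : IsEuclideanForm B) {c : Fin (rank E) → E} (hc : IsIdempotentSystem c) :
    IsJordanFrame c := by
  classical
  refine ⟨fun i => ⟨hc.idem i, hc.ne_zero i, ?_⟩, hc.orthogonal, hc.sum_eq_one⟩
  rintro ⟨p, q, hp, hq, hp0, hq0, hpq⟩
  obtain ⟨d, -, hd, -⟩ := exists_frame hJ hB (0 : E)
  have := hd.card_system_le hJ hB (hc.split hJ hB hp hq hp0 hq0 hpq)
  simp at this

/-- The mixed system has `#{a = t} + #{b ≠ t}` members, at most the size `#{b = t} + #{b ≠ t}` of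
the frame `d`. -/
lemma IsJordanFrame.card_filter_le (hJ : IsJordanAlgebra E) {B : LinearMap.BilinForm ℝ E}
    (hB : IsEuclideanForm B) {k m : ℕ} {c : Fin k → E} {d : Fin m → E} (hc : IsJordanFrame c)
    (hd : IsJordanFrame d) {a : Fin k → ℝ} {b : Fin m → ℝ}
    (h : ∑ i, a i • c i = ∑ j, b j • d j) (t : ℝ) :
    (Finset.univ.filter fun i => a i = t).card ≤ (Finset.univ.filter fun j => b j = t).card := by
  classical
  have h1 := hd.card_system_le hJ hB
    (isIdempotentSystem_mix hJ hB hc.isIdempotentSystem hd.isIdempotentSystem h t)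
  rw [Fintype.card_sum, Fintype.card_subtype, Fintype.card_subtype] at h1
  have h2 := Finset.card_filter_add_card_filter_not (s := (Finset.univ : Finset (Fin m)))
    (fun j => b j = t)
  simp only [Finset.card_univ, Fintype.card_fin, ne_eq] at h1 h2
  omega

lemma IsJordanFrame.spectralValues_eq (hJ : IsJordanAlgebra E) {B : LinearMap.BilinForm ℝ E}
    (hB : IsEuclideanForm B) {k : ℕ} {c : Fin k → E} (hc : IsJordanFrame c) (a : Fin k → ℝ) :
    spectralValues (∑ i, a i • c i) = Finset.univ.val.map a := by
  classical
  have hex : ∃ m, IsSpectrum (∑ i, a i • c i) m := ⟨_, k, c, a, hc, rfl, rfl⟩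
  rw [spectralValues, dif_pos hex]
  obtain ⟨m, d, b, hd, hx, hm⟩ := hex.choose_spec
  rw [hm]
  ext t
  rw [Multiset.count_map, Multiset.count_map]
  simp only [eq_comm (a := t)]
  exact le_antisymm (hd.card_filter_le hJ hB hc hx.symm t) (hc.card_filter_le hJ hB hd hx t)

lemma IsJordanFrame.det_eq (hJ : IsJordanAlgebra E) {B : LinearMap.BilinForm ℝ E}
    (hB : IsEuclideanForm B) {k : ℕ} {c : Fin k → E} (hc : IsJordanFrame c) (a : Fin k → ℝ) :
    det (∑ i, a i • c i) = ∏ i, a i := by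
  rw [det, hc.spectralValues_eq hJ hB]
  rfl

lemma IsJordanFrame.ind_eq (hJ : IsJordanAlgebra E) {B : LinearMap.BilinForm ℝ E}
    (hB : IsEuclideanForm B) {k : ℕ} {c : Fin k → E} (hc : IsJordanFrame c) (a : Fin k → ℝ) :
    ind (∑ i, a i • c i) = ∑ i, ((SignType.sign (a i) : SignType) : ℤ) := by
  rw [ind, hc.spectralValues_eq hJ hB, Multiset.map_map]
  rfl

/-- If `xy = 1` and `xc = 0`, then `B(c, c) = B(1, c) = B(xy, c) = B(y, xc) = 0`. -/
lemma mul_idem_ne_zero (hJ : IsJordanAlgebra E) {B : LinearMap.BilinForm ℝ E}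
    (hB : IsEuclideanForm B) {x c : E} (hx : x ∈ invertibles E) (hc : c * c = c) (h0 : c ≠ 0) :
    x * c ≠ 0 := by
  obtain ⟨y, hy, -⟩ := hx
  intro h
  have h1 := hB.assoc x y c
  have h2 := hB.assoc c 1 c
  rw [hy, h, map_zero] at h1
  rw [hJ.mul_one, hc, h1] at h2
  exact h0 (hB.eq_zero h2.le)

lemma IsIdempotentSystem.mem_invertibles_iff (hJ : IsJordanAlgebra E) {B : LinearMap.BilinForm ℝ E}
    (hB : IsEuclideanForm B) {ι : Type*} [Fintype ι] {c : ι → E} (hc : IsIdempotentSystem c)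
    (a : ι → ℝ) : (∑ i, a i • c i) ∈ invertibles E ↔ ∀ i, a i ≠ 0 := by
  constructor
  · intro h i h0
    refine mul_idem_ne_zero hJ hB h (hc.idem i) (hc.ne_zero i) ?_
    rw [hc.mul_sum_smul hJ, h0, zero_smul]
  · intro h
    refine ⟨∑ i, (a i)⁻¹ • c i, ?_, ?_⟩
    · rw [hc.sum_mul_sum hJ, ← hc.sum_eq_one]
      exact Finset.sum_congr rfl fun i _ => by rw [mul_inv_cancel₀ (h i), one_smul]
    · rw [hc.sum_mul_sum hJ, hc.sum_mul_sum hJ]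
      exact Finset.sum_congr rfl fun i _ => by rw [mul_assoc, mul_inv_cancel₀ (h i), mul_one]

lemma isOpen_of_seq {S : Set E}
    (h : ∀ (x : ℕ → E) (x₀ : E), x₀ ∈ S → Tendsto x atTop (𝓝 x₀) → ∃ n, x n ∈ S) : IsOpen S := by
  rw [← isClosed_compl_iff, ← isSeqClosed_iff_isClosed]
  intro x x₀ hx hlim h₀
  obtain ⟨n, hn⟩ := h x x₀ h₀ hlim
  exact hx n hn

/-- The invertible elements of a given index form an open set. -/
lemma isOpen_invertiblesOfIndex (hJ : IsJordanAlgebra E) {B : LinearMap.BilinForm ℝ E}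
    (hB : IsEuclideanForm B) (j : ℤ) : IsOpen (invertiblesOfIndex E j) := by
  refine isOpen_of_seq fun x x₀ hx₀ hlim => ?_
  choose c a hc ha using fun n => exists_frame hJ hB (x n)
  obtain ⟨φ, c₀, a₀, -, hc₀, ha₀, h₀⟩ :=
    exists_subseq_decomposition hJ hB hlim (fun n => (hc n).isIdempotentSystem) ha
  -- The limit system has `rank E` members, so it is a frame and computes the index of `x₀`. Its
  -- coefficients are nonzero, so signs are eventually constant along the subsequence.
  have hf := hc₀.isJordanFrame hJ hB
  obtain ⟨hinv, hind⟩ := hx₀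
  rw [h₀, hc₀.mem_invertibles_iff hJ hB] at hinv
  rw [h₀, hf.ind_eq hJ hB] at hind
  have hev : ∀ i, ∀ᶠ n in atTop, SignType.sign (a (φ n) i) = SignType.sign (a₀ i) := by
    intro i
    have h1 : ContinuousAt SignType.sign (a₀ i) := continuousAt_sign_of_ne_zero (hinv i)
    have h2 := h1.tendsto.comp (tendsto_pi_nhds.mp ha₀ i)
    rw [nhds_discrete, tendsto_pure] at h2
    exact h2
  obtain ⟨n, hn⟩ := (eventually_all.mpr hev).exists
  refine ⟨φ n, ?_, ?_⟩
  · rw [ha, (hc _).isIdempotentSystem.mem_invertibles_iff hJ hB]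
    intro i h0
    have := hn i
    rw [h0, sign_zero, eq_comm, sign_eq_zero_iff] at this
    exact hinv i this
  · rw [ha, (hc _).ind_eq hJ hB, ← hind]
    exact Finset.sum_congr rfl fun i _ => by rw [hn i]

lemma exists_mem_invertiblesOfIndex (hJ : IsJordanAlgebra E) {B : LinearMap.BilinForm ℝ E}
    (hB : IsEuclideanForm B) {k : ℕ} (hk : k ≤ rank E) :
    (invertiblesOfIndex E ((rank E : ℤ) - 2 * k)).Nonempty := by
  obtain ⟨c, -, hc, -⟩ := exists_frame hJ hB (0 : E)
  refine ⟨∑ i : Fin (rank E), (if (i : ℕ) < k then (-1 : ℝ) else 1) • c i, ?_, ?_⟩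
  · rw [hc.isIdempotentSystem.mem_invertibles_iff hJ hB]
    intro i
    split_ifs <;> norm_num
  · rw [hc.ind_eq hJ hB]
    have h1 : ∀ i : Fin (rank E), ((SignType.sign (if (i : ℕ) < k then (-1 : ℝ) else 1) : SignType) : ℤ)
        = 1 - 2 * (if (i : ℕ) < k then 1 else 0) := by
      intro i
      split_ifs
      · rw [Left.sign_neg, sign_one]; rfl
      · rw [sign_one]; rfl
    simp only [h1]
    rw [Finset.sum_sub_distrib, ← Finset.mul_sum,
      Fin.sum_univ_eq_sum_range (fun i => if i < k then (1 : ℤ) else 0), ← Finset.sum_filter]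
    have : (Finset.range (rank E)).filter (fun i => i < k) = Finset.range k := by
      ext i; simp; omega
    rw [this]
    simp

/-- Spectral values of invertible elements are bounded away from zero on compact sets. -/
lemma exists_spectral_lower_bound (hJ : IsJordanAlgebra E) {B : LinearMap.BilinForm ℝ E}
    (hB : IsEuclideanForm B) {K : Set E} (hK : IsCompact K) (hKi : K ⊆ invertibles E) :
    ∃ m : ℝ, 0 < m ∧ ∀ (k : ℕ) (c : Fin k → E) (a : Fin k → ℝ), IsIdempotentSystem c →
      ∑ i, a i • c i ∈ K → ∀ i, m ≤ |a i| := by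
  obtain ⟨R, hR, hRc⟩ := hB.exists_idem_bound hJ
  obtain ⟨M, hM, hMc⟩ := hJ.exists_mul_bound
  have hI : IsCompact {c : E | c * c = c ∧ 1 ≤ M * ‖c‖} := by
    refine Metric.isCompact_of_isClosed_isBounded ?_ ?_
    · exact (isClosed_eq (hJ.continuous_mul.comp (continuous_id.prodMk continuous_id))
        continuous_id).inter (isClosed_le continuous_const (continuous_const.mul continuous_norm))
    · refine (Metric.isBounded_closedBall (x := (0 : E)) (r := R)).subset fun c hc => ?_
      rw [mem_closedBall_zero_iff]
      exact hRc c hc.1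
  -- `x cᵢ = aᵢ cᵢ`, so a positive minimum of `‖x c‖` over `K` and the compact set of nonzero
  -- idempotents bounds `|aᵢ|` from below.
  obtain ⟨m, hm, hmin⟩ : ∃ m : ℝ, 0 < m ∧
      ∀ p ∈ K ×ˢ {c : E | c * c = c ∧ 1 ≤ M * ‖c‖}, m ≤ ‖p.1 * p.2‖ := by
    rcases (K ×ˢ {c : E | c * c = c ∧ 1 ≤ M * ‖c‖}).eq_empty_or_nonempty with h | h
    · exact ⟨1, one_pos, by simp [h]⟩
    · obtain ⟨p, hp, hpmin⟩ := (hK.prod hI).exists_isMinOn h hJ.continuous_mul.norm.continuousOn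
      refine ⟨_, norm_pos_iff.mpr (mul_idem_ne_zero hJ hB (hKi hp.1) hp.2.1 ?_),
        fun q hq => isMinOn_iff.mp hpmin q hq⟩
      intro h0
      have := hp.2.2
      rw [h0] at this
      norm_num at this
  refine ⟨m / R, by positivity, fun k c a hc hx i => ?_⟩
  have h1 := hmin (∑ i, a i • c i, c i) ⟨hx, hc.idem i, one_le_norm_idem hMc (hc.idem i) (hc.ne_zero i)⟩
  simp only [hc.mul_sum_smul hJ, norm_smul, Real.norm_eq_abs] at h1
  rw [div_le_iff₀ hR]
  exact h1.trans (mul_le_mul_of_nonneg_left (hRc _ (hc.idem i)) (abs_nonneg _))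

/-- Elements close to a positive multiple of the identity are interior points of the cone. -/
lemma mem_interior_cone (hJ : IsJordanAlgebra E) {B : LinearMap.BilinForm ℝ E}
    (hB : IsEuclideanForm B) {M : ℝ} (hMc : ∀ x y : E, ‖x * y‖ ≤ M * ‖x‖ * ‖y‖)
    {ε : ℝ} {v : E} (hv : M * ‖v‖ < ε) : ε • (1 : E) + v ∈ interior (cone E) := by
  have hU : IsOpen {z : E | M * ‖z - ε • (1 : E)‖ < ε} :=
    isOpen_lt (by fun_prop) continuous_const
  refine interior_maximal ?_ hU (a := ε • (1 : E) + v) (by simpa using hv)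
  intro z hz
  obtain ⟨c, a, hc, ha⟩ := exists_frame hJ hB z
  have hcs := hc.isIdempotentSystem
  have h1 : z - ε • (1 : E) = ∑ i, (a i - ε) • c i := by
    rw [← hc.sum_eq_one, ha, Finset.smul_sum, ← Finset.sum_sub_distrib]
    exact Finset.sum_congr rfl fun i _ => (sub_smul _ _ _).symm
  have hpos : ∀ i, 0 ≤ a i := by
    intro i
    have h2 := hcs.abs_coeff_le hJ hMc (fun i => a i - ε) i
    rw [← h1] at h2
    have h3 := (abs_lt.mp (h2.trans_lt hz)).1
    linarith
  refine ⟨∑ i, √(a i) • c i, ?_⟩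
  rw [hcs.sum_mul_sum hJ, ha]
  exact Finset.sum_congr rfl fun i _ => by rw [Real.mul_self_sqrt (hpos i)]

end SpectralValues
end JordanRiesz

namespace JordanRiesz

/-! ### Damped Riesz measures, their Fourier transforms, and temperedness -/

section Riesz

variable {E : Type*} [NormedAddCommGroup E] [NormedSpace ℝ E] [FiniteDimensional ℝ E]
  [Mul E] [One E]

open Filter Topology ProbabilityTheory

lemma measurable_eval (x : E) : Measurable fun l : StrongDual ℝ E => l x :=
  (ContinuousLinearMap.apply ℝ ℝ x).continuous.measurable

/-- A measure on the dual space, damped by the factor `exp (-ε l(1))`. -/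
noncomputable def damped (μ : Measure (StrongDual ℝ E)) (ε : ℝ) : Measure (StrongDual ℝ E) :=
  μ.withDensity fun l => ENNReal.ofReal (Real.exp (-(ε * l 1)))

lemma measurable_damping (ε : ℝ) :
    Measurable fun l : StrongDual ℝ E => ENNReal.ofReal (Real.exp (-(ε * l 1))) :=
  ((measurable_eval 1).const_mul ε).neg.exp.ennreal_ofReal

lemma integral_damped {F : Type*} [NormedAddCommGroup F] [NormedSpace ℝ F]
    (μ : Measure (StrongDual ℝ E)) (ε : ℝ) (f : StrongDual ℝ E → F) :
    ∫ l, f l ∂(damped μ ε) = ∫ l, Real.exp (-(ε * l 1)) • f l ∂μ := by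
  rw [damped, integral_withDensity_eq_integral_toReal_smul (measurable_damping ε) (by simp)]
  simp only [ENNReal.toReal_ofReal (Real.exp_pos _).le]

lemma integrable_damped {F : Type*} [NormedAddCommGroup F] [NormedSpace ℝ F]
    (μ : Measure (StrongDual ℝ E)) (ε : ℝ) (f : StrongDual ℝ E → F) :
    Integrable f (damped μ ε) ↔ Integrable (fun l => Real.exp (-(ε * l 1)) • f l) μ := by
  rw [damped, integrable_withDensity_iff_integrable_smul' (measurable_damping ε) (by simp)]
  simp only [ENNReal.toReal_ofReal (Real.exp_pos _).le]

variable {B : LinearMap.BilinForm ℝ E} {s : ℝ} {μ : Measure (StrongDual ℝ E)}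

namespace IsRieszMeasure

lemma ae_nonneg (hμ : IsRieszMeasure s μ) (hJ : IsJordanAlgebra E) : ∀ᵐ l ∂μ, 0 ≤ l (1 : E) := by
  have h : ∀ᵐ l ∂μ, l ∈ dualCone E := by
    rw [ae_iff]
    exact hμ.support
  filter_upwards [h] with l hl using hl 1 ⟨1, (hJ.one_mul 1).symm⟩

lemma integrable_exp (hμ : IsRieszMeasure s μ) (hJ : IsJordanAlgebra E) (hB : IsEuclideanForm B)
    {ε : ℝ} (hε : 0 < ε) : Integrable (fun l : StrongDual ℝ E => Real.exp (-(ε * l 1))) μ := by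
  obtain ⟨M, hM, hMc⟩ := hJ.exists_mul_bound
  have := hμ.integrable _ (mem_interior_cone hJ hB hMc (ε := ε) (v := 0) (by simpa using hε))
  simpa using this

lemma isFiniteMeasure_damped (hμ : IsRieszMeasure s μ) (hJ : IsJordanAlgebra E)
    (hB : IsEuclideanForm B) {ε : ℝ} (hε : 0 < ε) : IsFiniteMeasure (damped μ ε) :=
  isFiniteMeasure_withDensity_ofReal (hμ.integrable_exp hJ hB hε).2

lemma laplace_one (hμ : IsRieszMeasure s μ) (hJ : IsJordanAlgebra E) (hB : IsEuclideanForm B)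
    {ε : ℝ} (hε : 0 < ε) :
    ∫ l : StrongDual ℝ E, Real.exp (-(ε * l 1)) ∂μ = (ε ^ rank E) ^ (-s) := by
  obtain ⟨M, hM, hMc⟩ := hJ.exists_mul_bound
  have h := hμ.laplace _ (mem_interior_cone hJ hB hMc (ε := ε) (v := 0) (by simpa using hε))
  obtain ⟨c, -, hc, -⟩ := exists_frame hJ hB (0 : E)
  have h1 : ε • (1 : E) + 0 = ∑ i, ε • c i := by
    rw [add_zero, ← Finset.smul_sum, hc.sum_eq_one]
  have h2 := hc.det_eq hJ hB fun _ => ε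
  rw [← h1, Finset.prod_const, Finset.card_univ, Fintype.card_fin] at h2
  rw [h2] at h
  simpa using h

/-- The Fourier transform of the damped Riesz measure. -/
lemma fourier_damped (hμ : IsRieszMeasure s μ) (hJ : IsJordanAlgebra E) (hB : IsEuclideanForm B)
    {ε : ℝ} (hε : 0 < ε) {r : ℕ} {c : Fin r → E} (hc : IsJordanFrame c) (a : Fin r → ℝ) :
    ∫ l : StrongDual ℝ E, Complex.exp (Complex.I * ((l (∑ i, a i • c i) : ℝ) : ℂ)) ∂(damped μ ε) =
      ∏ i, ((ε : ℂ) - Complex.I * a i) ^ (-(s : ℂ)) := by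
  obtain ⟨M, hM, hMc⟩ := hJ.exists_mul_bound
  have hcs := hc.isIdempotentSystem
  set x := ∑ i, a i • c i with hx
  -- For `|u| < δ` the point `ε1 + ux` stays in the open cone and all `ε + u aᵢ` are positive.
  set δ := ε / (M * ‖x‖ + 1) with hδ
  have hpos : 0 < M * ‖x‖ + 1 := by positivity
  have hδ0 : 0 < δ := by positivity
  have hu : ∀ u : ℝ, |u| < δ → M * ‖u • x‖ < ε := by
    intro u hu
    rw [hδ, lt_div_iff₀ hpos] at hu
    rw [norm_smul, Real.norm_eq_abs]
    nlinarith [abs_nonneg u, norm_nonneg x]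
  have hua : ∀ u : ℝ, |u| < δ → ∀ i, 0 < ε + u * a i := by
    intro u h i
    have h1 : |u * a i| ≤ M * ‖u • x‖ := by
      rw [abs_mul, norm_smul, Real.norm_eq_abs]
      have := hcs.abs_coeff_le hJ hMc a i
      rw [← hx] at this
      nlinarith [abs_nonneg u]
    have := (abs_lt.mp (h1.trans_lt (hu u h))).1
    linarith
  have hexp : ∀ (u : ℝ) (l : StrongDual ℝ E),
      Real.exp (-(ε * l 1)) * Real.exp (u * -(l x)) = Real.exp (-(l (ε • (1 : E) + u • x))) := by
    intro u l
    rw [← Real.exp_add, map_add, map_smul, map_smul, smul_eq_mul, smul_eq_mul]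
    ring_nf
  let X : StrongDual ℝ E → ℝ := fun l => -(l x)
  have hmgf : ∀ u : ℝ, |u| < δ → mgf X (damped μ ε) u = ∏ i, (ε + u * a i) ^ (-s) := by
    intro u h
    rw [mgf, integral_damped]
    simp only [smul_eq_mul, X, hexp]
    rw [hμ.laplace _ (mem_interior_cone hJ hB hMc (hu u h))]
    have h1 : ε • (1 : E) + u • x = ∑ i, (ε + u * a i) • c i := by
      rw [← hc.sum_eq_one, hx, Finset.smul_sum, Finset.smul_sum, ← Finset.sum_add_distrib]
      exact Finset.sum_congr rfl fun i _ => by rw [smul_smul, add_smul]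
    rw [h1, hc.det_eq hJ hB, Real.finsetProd_rpow _ _ fun i _ => (hua u h i).le]
  have hint : Set.Ioo (-δ) δ ⊆ integrableExpSet X (damped μ ε) := by
    intro u h
    change Integrable _ _
    rw [integrable_damped]
    simp only [smul_eq_mul, X, hexp]
    exact hμ.integrable _ (mem_interior_cone hJ hB hMc (hu u (abs_lt.mpr h)))
  -- On this strip the moment generating function of `-λ(x)` is analytic, and every factor `ε + z
  -- aᵢ` has positive real part, away from the branch cut.
  let U : Set ℂ := Complex.re ⁻¹' Set.Ioo (-δ) δ
  have hUconv : IsPreconnected U :=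
    ((convex_Ioo (-δ) δ).linear_preimage Complex.reLm).isPreconnected
  have hf : AnalyticOnNhd ℂ (complexMGF X (damped μ ε)) U := fun z hz =>
    analyticAt_complexMGF (interior_maximal hint isOpen_Ioo hz)
  have hg : AnalyticOnNhd ℂ (fun z : ℂ => ∏ i, ((ε : ℂ) + z * a i) ^ (-(s : ℂ))) U := by
    intro z hz
    refine Finset.analyticAt_fun_prod _ fun i _ => ?_
    refine AnalyticAt.cpow (analyticAt_const.add (analyticAt_id.mul analyticAt_const))
      analyticAt_const (Or.inl ?_)
    simpa using hua z.re (abs_lt.mpr hz) i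
  have hreal : ∀ u : ℝ, |u| < δ →
      complexMGF X (damped μ ε) u = ∏ i, ((ε : ℂ) + u * a i) ^ (-(s : ℂ)) := by
    intro u h
    rw [complexMGF_ofReal, hmgf u h, Complex.ofReal_prod]
    refine Finset.prod_congr rfl fun i _ => ?_
    rw [Complex.ofReal_cpow (hua u h i).le]
    push_cast
    rfl
  have hfreq : ∃ᶠ z in 𝓝[≠] (0 : ℂ), complexMGF X (damped μ ε) z =
      ∏ i, ((ε : ℂ) + z * a i) ^ (-(s : ℂ)) := by
    have ht : Tendsto (fun u : ℝ => (u : ℂ)) (𝓝[>] 0) (𝓝[≠] (0 : ℂ)) := by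
      refine tendsto_nhdsWithin_iff.mpr ⟨?_, ?_⟩
      · exact (Complex.continuous_ofReal.tendsto' 0 0 rfl).mono_left nhdsWithin_le_nhds
      · filter_upwards [self_mem_nhdsWithin] with u hu
        exact Complex.ofReal_ne_zero.mpr (ne_of_gt hu)
    refine ht.frequently (Eventually.frequently ?_)
    filter_upwards [Ioo_mem_nhdsGT hδ0] with u hu
    exact hreal u (abs_lt.mpr ⟨by linarith [hu.1], hu.2⟩)
  -- At `z = -i` the integrand `exp(z · (-λ(x)))` becomes `exp(iλ(x))`.
  have key := hf.eqOn_of_preconnected_of_frequently_eq hg hUconv (z₀ := 0)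
    (by simp [U, hδ0]) hfreq (x := -Complex.I) (by simp [U, hδ0])
  simp only [complexMGF, X] at key
  refine Eq.trans ?_ (key.trans ?_)
  · refine integral_congr_ae (Eventually.of_forall fun l => ?_)
    simp
  · refine Finset.prod_congr rfl fun i _ => ?_
    rw [neg_mul, sub_eq_add_neg]

/-- The function `(1 + l(1))^{-N}` is integrable for the Riesz measure, for large `N`. -/
lemma exists_integrable_pow (hμ : IsRieszMeasure s μ) (hJ : IsJordanAlgebra E)
    (hB : IsEuclideanForm B) :
    ∃ N : ℕ, Integrable (fun l : StrongDual ℝ E => ((1 + |l (1 : E)|) ^ N)⁻¹) μ := by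
  obtain ⟨m, hm⟩ := exists_nat_ge ((rank E : ℝ) * s)
  refine ⟨m + 2, ?_, ?_⟩
  · exact ((((measurable_eval 1).abs.const_add 1).pow_const _).inv).aestronglyMeasurable
  -- The Laplace integral at `1/(n+1)` is `(n+1)^(rs) ≤ (n+1)^m`, so the extra exponent `2` makes
  -- the integrals of the `g n` summable. With `n = ⌊λ(1)⌋` the exponential is at least `e⁻¹`, which
  -- the factor `e` offsets.
  let g : ℕ → StrongDual ℝ E → ℝ := fun n l =>
    Real.exp 1 * (((n : ℝ) + 1) ^ (m + 2))⁻¹ * Real.exp (-(((n : ℝ) + 1)⁻¹ * l 1))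
  have hn : ∀ n : ℕ, (0 : ℝ) < (n : ℝ) + 1 := fun n => by positivity
  have hgi : ∀ n, Integrable (g n) μ := fun n =>
    (hμ.integrable_exp hJ hB (inv_pos.mpr (hn n))).const_mul _
  have hg0 : ∀ n l, 0 ≤ g n l := fun n l => by positivity
  have hgint : ∀ n, ∫ l, g n l ∂μ ≤ Real.exp 1 * (1 / ((n : ℝ) + 1) ^ 2) := by
    intro n
    simp only [g]
    rw [integral_const_mul, hμ.laplace_one hJ hB (inv_pos.mpr (hn n)), mul_assoc]
    refine mul_le_mul_of_nonneg_left ?_ (Real.exp_pos 1).le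
    rw [inv_pow, ← Real.rpow_natCast _ (rank E), Real.inv_rpow (by positivity),
      Real.rpow_neg (by positivity), inv_inv, ← Real.rpow_mul (hn n).le]
    have h1 : ((n : ℝ) + 1) ^ ((rank E : ℝ) * s) ≤ ((n : ℝ) + 1) ^ m := by
      rw [← Real.rpow_natCast]
      exact Real.rpow_le_rpow_of_exponent_le (by linarith [n.cast_nonneg (α := ℝ)]) hm
    calc (((n : ℝ) + 1) ^ (m + 2))⁻¹ * ((n : ℝ) + 1) ^ ((rank E : ℝ) * s)
        ≤ (((n : ℝ) + 1) ^ (m + 2))⁻¹ * ((n : ℝ) + 1) ^ m := by gcongr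
      _ = 1 / ((n : ℝ) + 1) ^ 2 := by
        rw [pow_add]
        field_simp
  have hsum : Summable fun n : ℕ => Real.exp 1 * (1 / ((n : ℝ) + 1) ^ 2) := by
    refine Summable.mul_left _ ?_
    have := (summable_nat_add_iff 1).mpr (Real.summable_one_div_nat_pow.mpr one_lt_two)
    simpa using this
  have hpt : ∀ l : StrongDual ℝ E, 0 ≤ l (1 : E) →
      ((1 + |l (1 : E)|) ^ (m + 2))⁻¹ ≤ g ⌊l (1 : E)⌋₊ l := by
    intro l hl
    have h1 := Nat.floor_le hl
    have h2 := Nat.lt_floor_add_one (l (1 : E))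
    set n := ⌊l (1 : E)⌋₊
    have h3 : 1 ≤ Real.exp 1 * Real.exp (-(((n : ℝ) + 1)⁻¹ * l 1)) := by
      rw [← Real.exp_add, Real.one_le_exp_iff]
      have : ((n : ℝ) + 1)⁻¹ * l 1 ≤ 1 := by
        rw [inv_mul_le_iff₀ (hn n)]
        linarith
      linarith
    have h4 : ((1 + |l (1 : E)|) ^ (m + 2))⁻¹ ≤ (((n : ℝ) + 1) ^ (m + 2))⁻¹ := by
      rw [abs_of_nonneg hl]
      gcongr ?_⁻¹
      exact pow_le_pow_left₀ (hn n).le (by linarith) _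
    calc _ ≤ (((n : ℝ) + 1) ^ (m + 2))⁻¹ * 1 := by rw [_root_.mul_one]; exact h4
      _ ≤ (((n : ℝ) + 1) ^ (m + 2))⁻¹ * (Real.exp 1 * Real.exp (-(((n : ℝ) + 1)⁻¹ * l 1))) := by
        gcongr
      _ = g n l := by simp only [g]; ring
  calc ∫⁻ l, ‖((1 + |l (1 : E)|) ^ (m + 2))⁻¹‖ₑ ∂μ
      ≤ ∫⁻ l, ∑' n, ENNReal.ofReal (g n l) ∂μ := by
        refine lintegral_mono_ae ?_
        filter_upwards [hμ.ae_nonneg hJ] with l hl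
        refine le_trans ?_ (ENNReal.le_tsum ⌊l (1 : E)⌋₊)
        rw [Real.enorm_eq_ofReal (by positivity)]
        exact ENNReal.ofReal_le_ofReal (hpt l hl)
    _ = ∑' n, ENNReal.ofReal (∫ l, g n l ∂μ) := by
        rw [lintegral_tsum fun n => (hgi n).aemeasurable.ennreal_ofReal]
        exact tsum_congr fun n => (ofReal_integral_eq_lintegral_ofReal (hgi n)
          (Eventually.of_forall (hg0 n))).symm
    _ ≤ ∑' n : ℕ, ENNReal.ofReal (Real.exp 1 * (1 / ((n : ℝ) + 1) ^ 2)) :=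
        ENNReal.tsum_le_tsum fun n => ENNReal.ofReal_le_ofReal (hgint n)
    _ < ⊤ := by
        rw [← ENNReal.ofReal_tsum_of_nonneg (fun n => by positivity) hsum]
        exact ENNReal.ofReal_lt_top

lemma hasTemperateGrowth (hμ : IsRieszMeasure s μ) (hJ : IsJordanAlgebra E)
    (hB : IsEuclideanForm B) : μ.HasTemperateGrowth := by
  obtain ⟨N, hN⟩ := hμ.exists_integrable_pow hJ hB
  refine ⟨N, (hN.const_mul ((1 + ‖(1 : E)‖) ^ N)).mono' ?_ (Eventually.of_forall fun l => ?_)⟩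
  · exact ((measurable_norm.const_add 1).pow_const _).aestronglyMeasurable
  · have h1 : |l (1 : E)| ≤ ‖l‖ * ‖(1 : E)‖ := l.le_opNorm 1
    have h2 : 1 + |l (1 : E)| ≤ (1 + ‖(1 : E)‖) * (1 + ‖l‖) := by
      nlinarith [norm_nonneg l, norm_nonneg (1 : E)]
    rw [Real.norm_of_nonneg (by positivity), Real.rpow_neg (by positivity), Real.rpow_natCast,
      ← div_eq_mul_inv, le_div_iff₀ (by positivity), inv_mul_le_iff₀ (by positivity), ← mul_pow]
    exact pow_le_pow_left₀ (by positivity) (by linarith) _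

end IsRieszMeasure
end Riesz
end JordanRiesz

namespace JordanRiesz

/-! ### Decay of Fourier integrals of test functions -/

section TestFunctions

variable {E : Type*} [NormedAddCommGroup E] [NormedSpace ℝ E] [FiniteDimensional ℝ E]
  [MeasurableSpace E] [BorelSpace E]

open Filter Topology

/-- The Fourier integral of a test function, as a function on the dual space. -/
noncomputable def fourierIntegral (ν : Measure E) (ψ : E → ℂ) (l : StrongDual ℝ E) : ℂ :=
  ∫ x : E, Complex.exp (Complex.I * ((l x : ℝ) : ℂ)) * ψ x ∂ν

lemma norm_exp_I_mul (t : ℝ) : ‖Complex.exp (Complex.I * (t : ℂ))‖ = 1 := by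
  rw [mul_comm]
  exact Complex.norm_exp_ofReal_mul_I t

lemma continuous_character (l : StrongDual ℝ E) :
    Continuous fun x : E => Complex.exp (Complex.I * ((l x : ℝ) : ℂ)) := by
  fun_prop

variable (ν : Measure E) [ν.IsAddHaarMeasure]

lemma integrable_character_mul {ψ : E → ℂ} (hψ : Continuous ψ) (hc : HasCompactSupport ψ)
    (l : StrongDual ℝ E) :
    Integrable (fun x : E => Complex.exp (Complex.I * ((l x : ℝ) : ℂ)) * ψ x) ν :=
  ((continuous_character l).mul hψ).integrable_of_hasCompactSupport hc.mul_left

lemma continuous_fourierIntegral {ψ : E → ℂ} (hψ : Continuous ψ) (hc : HasCompactSupport ψ) :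
    Continuous (fourierIntegral ν ψ) := by
  refine continuous_of_dominated (bound := fun x => ‖ψ x‖)
    (fun l => ((continuous_character l).mul hψ).aestronglyMeasurable)
    (fun l => Eventually.of_forall fun x => ?_) (hψ.integrable_of_hasCompactSupport hc).norm
    (Eventually.of_forall fun x => ?_)
  · rw [norm_mul, norm_exp_I_mul, one_mul]
  · have : Continuous fun l : StrongDual ℝ E => l x :=
      (ContinuousLinearMap.apply ℝ ℝ x).continuous
    fun_prop

/-- Integration by parts in the Fourier integral. -/
lemma fourierIntegral_fderiv {ψ : E → ℂ} (hψ : ContDiff ℝ ∞ ψ) (hc : HasCompactSupport ψ)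
    (v : E) (l : StrongDual ℝ E) :
    fourierIntegral ν (fun x => fderiv ℝ ψ x v) l =
      -(Complex.I * ((l v : ℝ) : ℂ)) * fourierIntegral ν ψ l := by
  have hd : ∀ x, HasFDerivAt (fun x : E => Complex.exp (Complex.I * ((l x : ℝ) : ℂ)))
      (Complex.exp (Complex.I * ((l x : ℝ) : ℂ)) • (Complex.I • (Complex.ofRealCLM.comp l))) x := by
    intro x
    exact (((Complex.ofRealCLM.comp l).hasFDerivAt (x := x)).const_mul Complex.I).cexp
  have hfd : ∀ x, fderiv ℝ (fun x : E => Complex.exp (Complex.I * ((l x : ℝ) : ℂ))) x v =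
      (Complex.I * ((l v : ℝ) : ℂ)) * Complex.exp (Complex.I * ((l x : ℝ) : ℂ)) := by
    intro x
    rw [(hd x).fderiv]
    simp [mul_comm]
  have hcd : Continuous fun x => fderiv ℝ ψ x v :=
    (hψ.continuous_fderiv (by simp)).clm_apply continuous_const
  have hcc : HasCompactSupport fun x => fderiv ℝ ψ x v := hc.fderiv_apply ℝ v
  have h := integral_mul_fderiv_eq_neg_fderiv_mul_of_integrable (μ := ν) (v := v)
    (f := fun x : E => Complex.exp (Complex.I * ((l x : ℝ) : ℂ))) (g := ψ) ?_
    (integrable_character_mul ν hcd hcc l) (integrable_character_mul ν hψ.continuous hc l)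
    (fun x _ => (hd x).differentiableAt) (fun x _ => hψ.differentiable (by simp) x)
  · rw [fourierIntegral, h, fourierIntegral, neg_mul, ← integral_const_mul]
    simp only [hfd, mul_assoc]
  · simp only [hfd, mul_assoc]
    exact (integrable_character_mul ν hψ.continuous hc l).const_mul _ |>.const_mul _

/-- Repeated integration by parts along the single direction `v`. Decay in `λ(1)` is all that is
needed, since a power of `1 + |λ(1)|` already controls the Riesz measure. -/
lemma exists_decay_fourierIntegral (v : E) (N : ℕ) : ∀ {ψ : E → ℂ}, ContDiff ℝ ∞ ψ →
    HasCompactSupport ψ → ∃ C : ℝ, ∀ l, |l v| ^ N * ‖fourierIntegral ν ψ l‖ ≤ C := by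
  induction N with
  | zero =>
    intro ψ hψ hc
    refine ⟨∫ x, ‖ψ x‖ ∂ν, fun l => ?_⟩
    rw [pow_zero, one_mul]
    refine (norm_integral_le_integral_norm _).trans (le_of_eq ?_)
    simp only [norm_mul, norm_exp_I_mul, one_mul]
  | succ N ih =>
    intro ψ hψ hc
    have hψ' : ContDiff ℝ ∞ fun x => fderiv ℝ ψ x v :=
      (hψ.fderiv_right (m := ∞) (by simp)).clm_apply contDiff_const
    obtain ⟨C, hC⟩ := ih hψ' (hc.fderiv_apply ℝ v)
    refine ⟨C, fun l => le_trans (le_of_eq ?_) (hC l)⟩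
    rw [fourierIntegral_fderiv ν hψ hc, norm_mul, norm_neg, norm_mul, Complex.norm_I, one_mul,
      Complex.norm_real, Real.norm_eq_abs, pow_succ, mul_assoc]

lemma exists_bound_fourierIntegral (v : E) (N : ℕ) {ψ : E → ℂ} (hψ : ContDiff ℝ ∞ ψ)
    (hc : HasCompactSupport ψ) :
    ∃ C : ℝ, ∀ l, ‖fourierIntegral ν ψ l‖ ≤ C * ((1 + |l v|) ^ N)⁻¹ := by
  obtain ⟨C₀, h₀⟩ := exists_decay_fourierIntegral ν v 0 hψ hc
  obtain ⟨C₁, h₁⟩ := exists_decay_fourierIntegral ν v N hψ hc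
  refine ⟨2 ^ (N - 1) * (C₀ + C₁), fun l => ?_⟩
  rw [← div_eq_mul_inv, le_div_iff₀ (by positivity)]
  have h := add_pow_le zero_le_one (abs_nonneg (l v)) N
  have hl₀ := h₀ l
  have hl₁ := h₁ l
  rw [pow_zero, one_mul] at hl₀
  rw [one_pow] at h
  calc ‖fourierIntegral ν ψ l‖ * (1 + |l v|) ^ N
      ≤ ‖fourierIntegral ν ψ l‖ * (2 ^ (N - 1) * (1 + |l v| ^ N)) := by gcongr
    _ = 2 ^ (N - 1) * (‖fourierIntegral ν ψ l‖ + |l v| ^ N * ‖fourierIntegral ν ψ l‖) := by ring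
    _ ≤ _ := by gcongr

end TestFunctions

/-! ### Boundary values of the one-variable powers -/

section BoundaryValues

open Filter Topology

/-- The source of the index: `-ia` lies on the imaginary axis, where the principal argument is
`-sgn(a) π/2`. -/
lemma neg_I_mul_cpow {a : ℝ} (ha : a ≠ 0) (s : ℝ) :
    (-(Complex.I * a)) ^ (-(s : ℂ)) = ((|a| ^ (-s) : ℝ) : ℂ) *
      Complex.exp (((SignType.sign a : SignType) : ℤ) * (s * Real.pi * Complex.I / 2)) := by
  have hlog : Complex.log (-(Complex.I * a)) =
      Real.log |a| - ((SignType.sign a : SignType) : ℤ) * (Real.pi / 2 * Complex.I) := by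
    rcases lt_or_gt_of_ne ha with h | h
    · have e : -(Complex.I * a) = ((-a : ℝ) : ℂ) * Complex.I := by push_cast; ring
      rw [e, Complex.log_ofReal_mul (neg_pos.mpr h) Complex.I_ne_zero, Complex.log_I,
        abs_of_neg h, sign_neg h]
      simp
    · have e : -(Complex.I * a) = ((a : ℝ) : ℂ) * -Complex.I := by ring
      rw [e, Complex.log_ofReal_mul h (neg_ne_zero.mpr Complex.I_ne_zero), Complex.log_neg_I,
        abs_of_pos h, sign_pos h]
      simp [sub_eq_add_neg]
  have h0 : -(Complex.I * (a : ℂ)) ≠ 0 :=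
    neg_ne_zero.mpr (mul_ne_zero Complex.I_ne_zero (Complex.ofReal_ne_zero.mpr ha))
  rw [Complex.cpow_def_of_ne_zero h0, hlog, Real.rpow_def_of_pos (abs_pos.mpr ha),
    Complex.ofReal_exp, ← Complex.exp_add]
  congr 1
  push_cast
  ring

lemma tendsto_sub_I_mul_cpow {a : ℝ} (ha : a ≠ 0) (s : ℝ) {ε : ℕ → ℝ}
    (hε : Tendsto ε atTop (𝓝 0)) :
    Tendsto (fun n => ((ε n : ℂ) - Complex.I * a) ^ (-(s : ℂ))) atTop
      (𝓝 ((-(Complex.I * a)) ^ (-(s : ℂ)))) := by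
  have hs : -(Complex.I * (a : ℂ)) ∈ Complex.slitPlane := Or.inr (by simpa using ha)
  refine (continuousAt_cpow_const hs).tendsto.comp ?_
  have h := ((Complex.continuous_ofReal.tendsto 0).comp hε).sub_const (Complex.I * (a : ℂ))
  simpa using h

/-- The base has modulus between `m` and `1 + A`; one summand bounds the power for `s ≥ 0`, the
other for `s ≤ 0`. -/
lemma norm_sub_I_mul_cpow_le {a ε m A s : ℝ} (hm : 0 < m) (hma : m ≤ |a|) (haA : |a| ≤ A)
    (hε0 : 0 < ε) (hε1 : ε ≤ 1) :
    ‖((ε : ℂ) - Complex.I * a) ^ (-(s : ℂ))‖ ≤ m ^ (-s) + (1 + A) ^ (-s) := by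
  have e : -(s : ℂ) = ((-s : ℝ) : ℂ) := by push_cast; rfl
  rw [e, Complex.norm_cpow_real]
  set z : ℂ := (ε : ℂ) - Complex.I * a
  have h1 : m ≤ ‖z‖ := by
    have : |z.im| ≤ ‖z‖ := Complex.abs_im_le_norm z
    simp only [z, Complex.sub_im, Complex.ofReal_im, Complex.mul_im, Complex.I_re, Complex.ofReal_re,
      Complex.I_im, one_mul, zero_add, zero_sub, abs_neg, mul_zero] at this
    exact hma.trans this
  have h2 : ‖z‖ ≤ 1 + A := by
    refine (norm_sub_le _ _).trans ?_
    rw [norm_mul, Complex.norm_I, one_mul, Complex.norm_real, Complex.norm_real,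
      Real.norm_of_nonneg hε0.le, Real.norm_eq_abs]
    linarith
  have hA : 0 < 1 + A := by linarith
  rcases le_total 0 s with hs | hs
  · exact (Real.rpow_le_rpow_of_nonpos hm h1 (by linarith)).trans
      (le_add_of_nonneg_right (Real.rpow_nonneg hA.le _))
  · exact (Real.rpow_le_rpow (norm_nonneg _) h2 (by linarith)).trans
      (le_add_of_nonneg_left (Real.rpow_nonneg hm.le _))

end BoundaryValues
end JordanRiesz

namespace JordanRiesz

/-! ### The Fourier transform on the invertible elements and its imaginary part -/

section BoundaryDistribution

variable {E : Type*} [NormedAddCommGroup E] [NormedSpace ℝ E] [FiniteDimensional ℝ E]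
  [Mul E] [One E]

open Filter Topology

/-- The boundary value `|Δ(x)|^{-s} e^{ind(x) s π i / 2}`. -/
noncomputable def boundaryValue (s : ℝ) (x : E) : ℂ :=
  ((|det x| ^ (-s) : ℝ) : ℂ) * Complex.exp ((ind x : ℂ) * (s * Real.pi * Complex.I / 2))

/-- The Fourier transform of the damped measure, as a function on `E`. -/
noncomputable def dampedTransform (μ : Measure (StrongDual ℝ E)) (ε : ℝ) (x : E) : ℂ :=
  ∫ l : StrongDual ℝ E, Complex.exp (Complex.I * ((l x : ℝ) : ℂ)) ∂(damped μ ε)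

variable {B : LinearMap.BilinForm ℝ E} {s : ℝ} {μ : Measure (StrongDual ℝ E)}

lemma IsJordanFrame.boundaryValue_eq (hJ : IsJordanAlgebra E) (hB : IsEuclideanForm B) {r : ℕ}
    {c : Fin r → E} (hc : IsJordanFrame c) {a : Fin r → ℝ} (ha : ∀ i, a i ≠ 0) (s : ℝ) :
    boundaryValue s (∑ i, a i • c i) = ∏ i, (-(Complex.I * a i)) ^ (-(s : ℂ)) := by
  rw [boundaryValue, hc.det_eq hJ hB, hc.ind_eq hJ hB,
    Finset.prod_congr rfl fun i _ => neg_I_mul_cpow (ha i) s, Finset.prod_mul_distrib,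
    ← Complex.exp_sum, ← Finset.sum_mul, Finset.abs_prod, ← Complex.ofReal_prod,
    Real.finsetProd_rpow _ _ fun i _ => abs_nonneg _]
  push_cast
  rfl

lemma im_boundaryValue (s : ℝ) (x : E) :
    (boundaryValue s x).im = |det x| ^ (-s) * Real.sin (s * ind x * (Real.pi / 2)) := by
  have : (ind x : ℂ) * (s * Real.pi * Complex.I / 2) =
      ((s * ind x * (Real.pi / 2) : ℝ) : ℂ) * Complex.I := by push_cast; ring
  rw [boundaryValue, this, Complex.im_ofReal_mul, Complex.exp_ofReal_mul_I_im]

lemma norm_boundaryValue (s : ℝ) (x : E) : ‖boundaryValue s x‖ = |det x| ^ (-s) := by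
  have : (ind x : ℂ) * (s * Real.pi * Complex.I / 2) =
      ((s * ind x * (Real.pi / 2) : ℝ) : ℂ) * Complex.I := by push_cast; ring
  rw [boundaryValue, this, norm_mul, Complex.norm_exp_ofReal_mul_I, mul_one, Complex.norm_real,
    Real.norm_of_nonneg (by positivity)]

lemma det_ne_zero (hJ : IsJordanAlgebra E) (hB : IsEuclideanForm B) {x : E}
    (hx : x ∈ invertibles E) : det x ≠ 0 := by
  obtain ⟨c, a, hc, rfl⟩ := exists_frame hJ hB x
  rw [hc.isIdempotentSystem.mem_invertibles_iff hJ hB] at hx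
  rw [hc.det_eq hJ hB]
  exact Finset.prod_ne_zero_iff.mpr fun i _ => hx i

namespace IsRieszMeasure

lemma tendsto_dampedTransform (hμ : IsRieszMeasure s μ) (hJ : IsJordanAlgebra E)
    (hB : IsEuclideanForm B) {x : E} (hx : x ∈ invertibles E) {ε : ℕ → ℝ} (hε0 : ∀ n, 0 < ε n)
    (hε : Tendsto ε atTop (𝓝 0)) :
    Tendsto (fun n => dampedTransform μ (ε n) x) atTop (𝓝 (boundaryValue s x)) := by
  obtain ⟨c, a, hc, rfl⟩ := exists_frame hJ hB x
  rw [hc.isIdempotentSystem.mem_invertibles_iff hJ hB] at hx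
  rw [hc.boundaryValue_eq hJ hB hx]
  simp only [dampedTransform, hμ.fourier_damped hJ hB (hε0 _) hc]
  exact tendsto_finsetProd _ fun i _ => tendsto_sub_I_mul_cpow (hx i) s hε

lemma exists_dampedTransform_bound (hμ : IsRieszMeasure s μ) (hJ : IsJordanAlgebra E)
    (hB : IsEuclideanForm B) {K : Set E} (hK : IsCompact K) (hKi : K ⊆ invertibles E) :
    ∃ A : ℝ, ∀ x ∈ K, ∀ ε : ℝ, 0 < ε → ε ≤ 1 → ‖dampedTransform μ ε x‖ ≤ A := by
  obtain ⟨m, hm, hmK⟩ := exists_spectral_lower_bound hJ hB hK hKi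
  obtain ⟨M, hM, hMc⟩ := hJ.exists_mul_bound
  obtain ⟨R, hR⟩ := hK.isBounded.exists_norm_le
  refine ⟨(m ^ (-s) + (1 + M * R) ^ (-s)) ^ rank E, fun x hx ε hε0 hε1 => ?_⟩
  obtain ⟨c, a, hc, rfl⟩ := exists_frame hJ hB x
  rw [dampedTransform, hμ.fourier_damped hJ hB hε0 hc, norm_prod]
  refine (Finset.prod_le_prod (fun i _ => norm_nonneg _)
    (g := fun _ => m ^ (-s) + (1 + M * R) ^ (-s)) fun i _ => ?_).trans (by simp)
  exact norm_sub_I_mul_cpow_le hm (hmK _ c a hc.isIdempotentSystem hx i)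
    ((hc.isIdempotentSystem.abs_coeff_le hJ hMc a i).trans
      (mul_le_mul_of_nonneg_left (hR _ hx) hM.le)) hε0 hε1

lemma continuous_dampedTransform (hμ : IsRieszMeasure s μ) (hJ : IsJordanAlgebra E)
    (hB : IsEuclideanForm B) {ε : ℝ} (hε : 0 < ε) : Continuous (dampedTransform μ ε) := by
  have := hμ.isFiniteMeasure_damped hJ hB hε
  refine continuous_of_dominated (bound := fun _ => 1) (fun x => ?_)
    (fun x => Eventually.of_forall fun l => (norm_exp_I_mul _).le) (integrable_const _)
    (Eventually.of_forall fun l => by fun_prop)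
  have : Continuous fun l : StrongDual ℝ E => l x :=
    (ContinuousLinearMap.apply ℝ ℝ x).continuous
  exact Continuous.aestronglyMeasurable (by fun_prop)

variable [MeasurableSpace E] [BorelSpace E] (ν : Measure E) [ν.IsAddHaarMeasure]

lemma integral_fourierIntegral_damped (hμ : IsRieszMeasure s μ) (hJ : IsJordanAlgebra E)
    (hB : IsEuclideanForm B) {ε : ℝ} (hε : 0 < ε) {ψ : E → ℂ} (hψ : Continuous ψ)
    (hc : HasCompactSupport ψ) :
    ∫ l, fourierIntegral ν ψ l ∂(damped μ ε) = ∫ x, ψ x * dampedTransform μ ε x ∂ν := by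
  have := hμ.isFiniteMeasure_damped hJ hB hε
  have hev : Continuous fun p : StrongDual ℝ E × E => p.1 p.2 := isBoundedBilinearMap_apply.continuous
  simp only [fourierIntegral]
  rw [integral_integral_swap]
  · refine integral_congr_ae (Eventually.of_forall fun x => ?_)
    simp only [dampedTransform]
    rw [integral_mul_const, mul_comm]
  · refine ((hψ.integrable_of_hasCompactSupport hc).comp_snd (damped μ ε)).mono
      (Continuous.aestronglyMeasurable ?_) (Eventually.of_forall fun p => ?_)
    · exact (Complex.continuous_exp.comp
        (continuous_const.mul (Complex.continuous_ofReal.comp hev))).mul (hψ.comp continuous_snd)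
    · simp only [Function.uncurry, norm_mul, norm_exp_I_mul, one_mul, le_refl]

/-- The damping factor is at most `1` because `λ(1) ≥ 0` almost everywhere; the decay of the Fourier
integral in `λ(1)` supplies an integrable majorant. -/
lemma tendsto_integral_fourierIntegral (hμ : IsRieszMeasure s μ) (hJ : IsJordanAlgebra E)
    (hB : IsEuclideanForm B) {ε : ℕ → ℝ} (hε0 : ∀ n, 0 < ε n) (hε : Tendsto ε atTop (𝓝 0))
    {ψ : E → ℂ} (hψ : ContDiff ℝ ∞ ψ) (hc : HasCompactSupport ψ) :
    Tendsto (fun n => ∫ l, fourierIntegral ν ψ l ∂(damped μ (ε n))) atTop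
      (𝓝 (∫ l, fourierIntegral ν ψ l ∂μ)) := by
  obtain ⟨N, hN⟩ := hμ.exists_integrable_pow hJ hB
  obtain ⟨C, hC⟩ := exists_bound_fourierIntegral ν (1 : E) N hψ hc
  have hcont := continuous_fourierIntegral ν hψ.continuous hc
  simp only [integral_damped]
  refine tendsto_integral_of_dominated_convergence _ (fun n => ?_) (hN.const_mul C)
    (fun n => ?_) (Eventually.of_forall fun l => ?_)
  · have h1 : Measurable fun l : StrongDual ℝ E => Real.exp (-(ε n * l 1)) :=
      ((measurable_eval 1).const_mul (ε n)).neg.exp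
    exact h1.aestronglyMeasurable.smul hcont.aestronglyMeasurable
  · filter_upwards [hμ.ae_nonneg hJ] with l hl
    rw [norm_smul, Real.norm_of_nonneg (Real.exp_pos _).le]
    have h1 : Real.exp (-(ε n * l 1)) ≤ 1 :=
      Real.exp_le_one_iff.mpr (neg_nonpos.mpr (mul_nonneg (hε0 n).le hl))
    exact (mul_le_of_le_one_left (norm_nonneg _) h1).trans (hC l)
  · have h1 : Tendsto (fun n => Real.exp (-(ε n * l 1))) atTop (𝓝 1) := by
      have h := (hε.mul_const (l 1)).neg
      rw [zero_mul, neg_zero] at h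
      exact Real.exp_zero ▸ (Real.continuous_exp.tendsto 0).comp h
    simpa using h1.smul_const (fourierIntegral ν ψ l)

/-- On the invertible elements, the Fourier transform of the Riesz measure is a function. -/
lemma integral_fourierIntegral (hμ : IsRieszMeasure s μ) (hJ : IsJordanAlgebra E)
    (hB : IsEuclideanForm B) {ψ : E → ℂ} (hψ : IsTestFunctionOn (invertibles E) ψ) :
    Integrable (fun x => ψ x * boundaryValue s x) ν ∧
      ∫ l, fourierIntegral ν ψ l ∂μ = ∫ x, ψ x * boundaryValue s x ∂ν := by
  obtain ⟨hψs, hψc, hψi⟩ := hψ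
  let ε : ℕ → ℝ := fun n => 1 / ((n : ℝ) + 1)
  have hε0 : ∀ n, 0 < ε n := fun n => Nat.one_div_pos_of_nat
  have hε1 : ∀ n, ε n ≤ 1 := fun n => by
    rw [div_le_one (by positivity)]
    linarith [n.cast_nonneg (α := ℝ)]
  have hε : Tendsto ε atTop (𝓝 0) := tendsto_one_div_add_atTop_nhds_zero_nat
  obtain ⟨A, hA⟩ := hμ.exists_dampedTransform_bound hJ hB hψc hψi
  have hbound : ∀ n x, ‖ψ x * dampedTransform μ (ε n) x‖ ≤ ‖ψ x‖ * A := by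
    intro n x
    rw [norm_mul]
    by_cases hx : x ∈ tsupport ψ
    · exact mul_le_mul_of_nonneg_left (hA x hx _ (hε0 n) (hε1 n)) (norm_nonneg _)
    · simp [image_eq_zero_of_notMem_tsupport hx]
  have hlim : ∀ x, Tendsto (fun n => ψ x * dampedTransform μ (ε n) x) atTop
      (𝓝 (ψ x * boundaryValue s x)) := by
    intro x
    by_cases hx : x ∈ tsupport ψ
    · exact (hμ.tendsto_dampedTransform hJ hB (hψi hx) hε0 hε).const_mul _
    · simp [image_eq_zero_of_notMem_tsupport hx]
  have hmeas : ∀ n, AEStronglyMeasurable (fun x => ψ x * dampedTransform μ (ε n) x) ν := fun n =>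
    (hψs.continuous.mul (hμ.continuous_dampedTransform hJ hB (hε0 n))).aestronglyMeasurable
  have hint : Integrable (fun x => ‖ψ x‖ * A) ν :=
    (hψs.continuous.integrable_of_hasCompactSupport hψc).norm.mul_const A
  refine ⟨hint.mono' (aestronglyMeasurable_of_tendsto_ae atTop hmeas
    (Eventually.of_forall hlim)) (Eventually.of_forall fun x => ?_), ?_⟩
  · exact le_of_tendsto (hlim x).norm (Eventually.of_forall fun n => hbound n x)
  -- The same damped pairing is computed on the dual side and, by Fubini, on `E`; the two limits
  -- must agree.
  · refine tendsto_nhds_unique (hμ.tendsto_integral_fourierIntegral ν hJ hB hε0 hε hψs hψc) ?_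
    simp only [hμ.integral_fourierIntegral_damped ν hJ hB (hε0 _) hψs.continuous hψc]
    exact tendsto_integral_of_dominated_convergence _ hmeas hint
      (fun n => Eventually.of_forall (hbound n)) (Eventually.of_forall hlim)

end IsRieszMeasure

lemma IsTestFunctionOn.conj {U : Set E} {φ : E → ℂ} (hφ : IsTestFunctionOn U φ) :
    IsTestFunctionOn U fun x => conj (φ x) := by
  have hs : Function.support (fun x => conj (φ x)) = Function.support φ := by
    ext x; simp
  refine ⟨Complex.conjCLE.contDiff.comp hφ.smooth, ?_, ?_⟩
  · have := hφ.compact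
    rwa [HasCompactSupport, tsupport, hs]
  · have := hφ.support_subset
    rwa [tsupport, hs]

namespace IsRieszMeasure

variable [MeasurableSpace E] [BorelSpace E] (ν : Measure E) [ν.IsAddHaarMeasure]

lemma fourierDistribution_eq (hμ : IsRieszMeasure s μ) (hJ : IsJordanAlgebra E)
    (hB : IsEuclideanForm B) {φ : E → ℂ} (hφ : IsTestFunctionOn (invertibles E) φ) :
    fourierDistribution ν μ φ = ∫ x, conj (φ x) * boundaryValue s x ∂ν :=
  (hμ.integral_fourierIntegral ν hJ hB hφ.conj).2

lemma imPart_fourierDistribution (hμ : IsRieszMeasure s μ) (hJ : IsJordanAlgebra E)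
    (hB : IsEuclideanForm B) {φ : E → ℂ} (hφ : IsTestFunctionOn (invertibles E) φ) :
    imPart (fourierDistribution ν μ) φ =
      ∫ x, conj (φ x) * ((boundaryValue s x).im : ℂ) ∂ν := by
  have h1 := (hμ.integral_fourierIntegral ν hJ hB hφ.conj).1
  have h2 := (hμ.integral_fourierIntegral ν hJ hB hφ).1
  have h2' : Integrable (fun x => conj (φ x * boundaryValue s x)) ν :=
    (Complex.conjCLE.toContinuousLinearMap).integrable_comp h2
  rw [imPart, hμ.fourierDistribution_eq ν hJ hB hφ, hμ.fourierDistribution_eq ν hJ hB hφ.conj,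
    ← integral_conj]
  simp only [Complex.conj_conj]
  rw [← integral_sub h1 h2', ← integral_div]
  refine integral_congr_ae (Eventually.of_forall fun x => ?_)
  simp only [map_mul]
  rw [← mul_sub, Complex.sub_conj]
  field_simp [Complex.I_ne_zero]
  push_cast
  ring

/-- The index is constant on `E^×_j`, so there the imaginary part is `sin(sjπ/2)` times the positive
function `|Δ|^(-s)`. A nonnegative bump function pairs positively with the latter, so vanishing
forces the sine to be zero. -/
lemma vanishesOn_iff (hμ : IsRieszMeasure s μ) (hJ : IsJordanAlgebra E)
    (hB : IsEuclideanForm B) {j : ℤ} (hj : (invertiblesOfIndex E j).Nonempty) :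
    VanishesOn (imPart (fourierDistribution ν μ)) (invertiblesOfIndex E j) ↔
      ∃ m : ℤ, s * j = 2 * m := by
  have hsub : invertiblesOfIndex E j ⊆ invertibles E := fun x hx => hx.1
  have key : ∀ φ : E → ℂ, IsTestFunctionOn (invertiblesOfIndex E j) φ →
      imPart (fourierDistribution ν μ) φ =
        (Real.sin (s * j * (Real.pi / 2)) : ℂ) * ∫ x, conj (φ x) * ((|det x| ^ (-s) : ℝ) : ℂ) ∂ν := by
    intro φ hφ
    rw [hμ.imPart_fourierDistribution ν hJ hB
      ⟨hφ.smooth, hφ.compact, hφ.support_subset.trans hsub⟩, ← integral_const_mul]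
    refine integral_congr_ae (Eventually.of_forall fun x => ?_)
    simp only
    by_cases hx : x ∈ tsupport φ
    · rw [im_boundaryValue, (hφ.support_subset hx).2]
      push_cast
      ring
    · simp [image_eq_zero_of_notMem_tsupport hx]
  have hsin : (∃ m : ℤ, s * j = 2 * m) ↔ Real.sin (s * j * (Real.pi / 2)) = 0 := by
    rw [Real.sin_eq_zero_iff]
    refine exists_congr fun m => ?_
    constructor
    · intro h
      rw [h]; ring
    · intro h
      have := Real.pi_pos.ne'
      field_simp at h
      linarith
  rw [hsin]
  constructor
  · intro hv
    obtain ⟨x₀, hx₀⟩ := hj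
    have hopen := isOpen_invertiblesOfIndex hJ hB (E := E) j
    obtain ⟨f, hfs, hfc, hf, hfr, hf1⟩ :=
      exists_contDiff_tsupport_subset (n := ⊤) (hopen.mem_nhds hx₀)
    have hf0 : ∀ x, 0 ≤ f x := fun x => (hfr ⟨x, rfl⟩).1
    have hsupp : Function.support (fun x => (f x : ℂ)) = Function.support f := by
      ext x; simp
    have hφ : IsTestFunctionOn (invertiblesOfIndex E j) fun x => (f x : ℂ) :=
      ⟨Complex.ofRealCLM.contDiff.comp hf, by rwa [HasCompactSupport, tsupport, hsupp],
        by rwa [tsupport, hsupp]⟩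
    have hint : Integrable (fun x => f x * |det x| ^ (-s)) ν := by
      have h := (hμ.integral_fourierIntegral ν hJ hB (ψ := fun x => (f x : ℂ))
        ⟨hφ.smooth, hφ.compact, hφ.support_subset.trans hsub⟩).1.norm
      refine h.congr (Eventually.of_forall fun x => ?_)
      simp only [norm_mul, Complex.norm_real, norm_boundaryValue, Real.norm_of_nonneg (hf0 x)]
    have hpos : 0 < ∫ x, f x * |det x| ^ (-s) ∂ν := by
      rw [integral_pos_iff_support_of_nonneg (fun x => mul_nonneg (hf0 x) (by positivity)) hint]
      have hs : Function.support f ⊆ Function.support fun x => f x * |det x| ^ (-s) := by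
        intro x hx
        have hdet := det_ne_zero hJ hB (hsub (hfs (subset_tsupport f hx)))
        exact mul_ne_zero hx (Real.rpow_pos_of_pos (abs_pos.mpr hdet) _).ne'
      exact (hf.continuous.isOpen_support.measure_pos ν ⟨x₀, by simp [hf1]⟩).trans_le
        (measure_mono hs)
    have h := hv _ hφ
    rw [key _ hφ] at h
    simp only [Complex.conj_ofReal, ← Complex.ofReal_mul] at h
    rw [integral_complex_ofReal, ← Complex.ofReal_mul, Complex.ofReal_eq_zero] at h
    exact (mul_eq_zero.mp h).resolve_right hpos.ne'
  · intro h φ hφ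
    rw [key φ hφ, h]
    simp

end IsRieszMeasure
end BoundaryDistribution
end JordanRiesz

theorem mainTheorem7 {E : Type*} [NormedAddCommGroup E] [NormedSpace ℝ E]
    [FiniteDimensional ℝ E] [MeasurableSpace E] [BorelSpace E] [Mul E] [One E]
    (hE : JordanRiesz.IsSimpleEuclideanJordanAlgebra E)
    (ν : Measure E) [ν.IsAddHaarMeasure]
    (s : ℝ) (μ : Measure (StrongDual ℝ E)) (hμ : JordanRiesz.IsRieszMeasure s μ) :
    μ.HasTemperateGrowth ∧
    (∀ φ : E → ℂ, JordanRiesz.IsTestFunctionOn (JordanRiesz.invertibles E) φ →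
      Integrable (fun x => conj (φ x) * (((|JordanRiesz.det x| ^ (-s) : ℝ) : ℂ) *
        Complex.exp ((JordanRiesz.ind x : ℂ) * (s * Real.pi * Complex.I / 2)))) ν ∧
      JordanRiesz.fourierDistribution ν μ φ =
        ∫ x, conj (φ x) * (((|JordanRiesz.det x| ^ (-s) : ℝ) : ℂ) *
          Complex.exp ((JordanRiesz.ind x : ℂ) * (s * Real.pi * Complex.I / 2))) ∂ν) ∧
    (∀ j : ℤ, (∃ k : ℕ, k ≤ JordanRiesz.rank E ∧ j = (JordanRiesz.rank E : ℤ) - 2 * k) →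
      (JordanRiesz.VanishesOn
          (JordanRiesz.imPart (JordanRiesz.fourierDistribution ν μ))
          (JordanRiesz.invertiblesOfIndex E j) ↔
        ∃ m : ℤ, s * j = 2 * m)) := by
  have hJ := hE.toIsJordanAlgebra
  obtain ⟨B, hsymm, hpos, hassoc⟩ := hE.exists_inner
  have hB : JordanRiesz.IsEuclideanForm B := ⟨hsymm, hpos, hassoc⟩
  refine ⟨hμ.hasTemperateGrowth hJ hB, fun φ hφ =>
    hμ.integral_fourierIntegral ν hJ hB hφ.conj, ?_⟩
  rintro j ⟨k, hk, rfl⟩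
  exact hμ.vanishesOn_iff ν hJ hB (JordanRiesz.exists_mem_invertiblesOfIndex hJ hB hk)
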